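/- For a real random variable $X$ let $\|X\|_{\psi_1}=\inf\{s>0:\mathbb E\,e^{|X|/s}\le 2\}$. For a finite simple graph $G=(V,E)$ of maximum degree $\Delta$, let $\mathcal I(G)$ be the set of its independent sets, and for complex weights $W=(W_v)_{v\in V}$ and $\lambda\in\mathbb C$ put $$Z_G(\lambda W)=\sum_{I\in\mathcal I(G)}\lambda^{|I|}\prod_{v\in I}W_v,\qquad X_W(\lambda)=Z_G(\lambda W)\exp\Bigl(-\lambda\sum_{v\in V}W_v\Bigr).$$ Let $N_W(r)$ be the number of zeros of $\lambda\mapsto Z_G(\lambda W)$ in the open disc $\mathbb D(0,r)$, counted with multiplicity, and let $\mathbb E_\theta$ be the average over $\theta$ uniform on $[0,2\pi)$. Fix $K>0$. A random family $W$ is called admissible with variance $\nu$ if the $W_v$ are i.i.d. complex random variables with $$\mathbb E W_v=0,\qquad \mathbb E|W_v|^2=\nu,\qquad \sup_{\phi\in[0,2\pi)}\bigl\|\operatorname{Re}(e^{-i\phi}W_v)\bigr\|_{\psi_1}\le K\sqrt\nu .$$ (1) There are constants $c,C>0$ depending only on $K$ such that the following holds for every finite graph $G=(V,E)$ of maximum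 degree $\Delta$, every admissible $W$ with variance $\nu>0$, and every $R>0$ with $R\le c/\sqrt\nu$ and $\nu R^2\Delta\le c$. The quantity $\mathbb E_W|X_W(\lambda)|^2$ is finite and positive for $|\lambda|=R$, its logarithm is integrable over this circle, and $$\bigl|\mathbb E_\theta\log\mathbb E_W|X_W(Re^{i\theta})|^2\bigr|\le C\,|V|(1+\Delta)\nu^2R^4 .$$ Moreover, for all $0<r<R$, $$\mathbb E\,N_W(r)\le\frac{C|V|(1+\Delta)\nu^2R^4}{2\log(R/r)},\qquad \mathbb P\bigl[Z_G(\lambda W)\text{ has a zero in }\mathbb D(0,r)\bigr]\le\frac{C|V|(1+\Delta)\nu^2R^4}{2\log(R/r)} .$$ (2) Let $G_n=(V_n,E_n)$ be finite graphs of maximum degree $\Delta_n$, with admissible weights of variance $\nu_n$ (the law may depend on $n$, but $K$ does not), and let $R_n>0$ satisfy $\nu_n^2R_n^4(1+\Delta_n)|V_n|\to 0$. Then for all large $n$ the quantity $\mathbb E_W|X_W(\lambda)|^2$ is finite and positive for $|\lambda|=R_n$, with logarithm integrable over this circle, and $$\mathbb E_\theta\log\mathbb E_W|X_W(R_ne^{i\theta})|^2\to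 0 .$$ (3) For every $\varepsilon\in(0,1)$ there is a constant $C>0$ depending only on $\varepsilon$ and $K$ such that, for every sequence of finite graphs $G_n=(V_n,E_n)$ of maximum degree $\Delta_n$ with admissible weights of variance $\nu_n>0$ and every $\beta\in(0,1/4)$, writing $M_n=(1+\Delta_n)|V_n|$ and $R_n=\nu_n^{-1/2}M_n^{-1/4-\beta}$, one has for every $n$ $$\mathbb P\bigl[Z_{G_n}(\lambda W)\text{ has a zero in }\mathbb D(0,(1-\varepsilon)R_n)\bigr]\le C\,M_n^{-4\beta}.$$ (For an empty vertex set, $Z_{G_n}\equiv 1$ and both sides are read as $0$.) -/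

import Mathlib

open MeasureTheory ProbabilityTheory Filter Topology
open scoped ENNReal

universe u v

noncomputable section

namespace Hardcore

/-- The `ψ₁`-norm of a real random variable `X`, with values in `[0, ∞]`: the infimum of
all `s > 0` with `E exp (|X| / s) ≤ 2` (it is `∞` if there is no such `s`). -/
def psiOneNorm {Ω : Type v} [MeasurableSpace Ω] (P : Measure Ω) (X : Ω → ℝ) : ℝ≥0∞ :=
  ⨅ (s : ℝ) (_ : 0 < s) (_ : ∫⁻ ω, ENNReal.ofReal (Real.exp (|X ω| / s)) ∂P ≤ 2),
    ENNReal.ofReal s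

/-- `(W v)` is a family of i.i.d. complex random variables with mean zero, `E |W v|² = ν`, and
`sup_{φ ∈ [0, 2π)} ‖Re (e^{-iφ} W v)‖_{ψ₁} ≤ K √ν`.
(`IdentDistrib` contains the measurability of the `W v`.) -/
structure IsSubexpIID {V : Type u} {Ω : Type v} [MeasurableSpace Ω] (P : Measure Ω)
    (W : V → Ω → ℂ) (ν K : ℝ) : Prop where
  indep : iIndepFun W P
  identDistrib : ∀ x y : V, IdentDistrib (W x) (W y) P P
  memLp_two : ∀ x : V, MemLp (W x) 2 P
  mean_zero : ∀ x : V, ∫ ω, W x ω ∂P = 0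
  second_moment : ∀ x : V, ∫ ω, ‖W x ω‖ ^ 2 ∂P = ν
  subexp : ∀ x : V,
    ⨆ φ ∈ Set.Ico (0 : ℝ) (2 * Real.pi),
      psiOneNorm P (fun ω => (Complex.exp (-(Complex.I * (φ : ℂ))) * W x ω).re)
      ≤ ENNReal.ofReal (K * Real.sqrt ν)

open Classical in
/-- The hardcore partition function of the finite graph `G` with complex vertex fugacities `w`:
the sum over all independent sets `I` of `∏ x ∈ I, w x`. -/
def partitionFn {V : Type u} [Fintype V] (G : SimpleGraph V) (w : V → ℂ) : ℂ :=
  ∑ I : Finset V with G.IsIndepSet (I : Set V), ∏ x ∈ I, w x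

/-- `Z_G (z w)` as a function of `z`, for fixed vertex weights `w`. -/
def partitionPoly {V : Type u} [Fintype V] (G : SimpleGraph V) (w : V → ℂ) (z : ℂ) : ℂ :=
  partitionFn G (fun x => z * w x)

/-- The first-order reweighting `X_w (z) = Z_G (z w) exp (- z ∑ x, w x)`. -/
def reweighted {V : Type u} [Fintype V] (G : SimpleGraph V) (w : V → ℂ) (z : ℂ) : ℂ :=
  partitionPoly G w z * Complex.exp (-(z * ∑ x, w x))

/-- The second moment `E_W |X_W (z)|²`. -/
def secondMoment {V : Type u} [Fintype V] (G : SimpleGraph V) {Ω : Type v} [MeasurableSpace Ω]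
    (P : Measure Ω) (W : V → Ω → ℂ) (z : ℂ) : ℝ :=
  ∫ ω, ‖reweighted G (fun x => W x ω) z‖ ^ 2 ∂P

/-- `E_W |X_W (z)|²` is finite and positive for every `z` with `|z| = R`, and its logarithm is
integrable over that circle. -/
def LogSecondMomentWellDefined {V : Type u} [Fintype V] (G : SimpleGraph V) {Ω : Type v}
    [MeasurableSpace Ω] (P : Measure Ω) (W : V → Ω → ℂ) (R : ℝ) : Prop :=
  (∀ z : ℂ, ‖z‖ = R →
    Integrable (fun ω => ‖reweighted G (fun x => W x ω) z‖ ^ 2) P ∧ 0 < secondMoment G P W z) ∧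
  CircleIntegrable (fun z => Real.log (secondMoment G P W z)) 0 R

/-- `E_θ log E_W |X_W (R e^{iθ})|²` for `θ` uniform on `[0, 2π)`. -/
def avgLogSecondMoment {V : Type u} [Fintype V] (G : SimpleGraph V) {Ω : Type v}
    [MeasurableSpace Ω] (P : Measure Ω) (W : V → Ω → ℂ) (R : ℝ) : ℝ :=
  Real.circleAverage (fun z => Real.log (secondMoment G P W z)) 0 R

/-- The number of zeros of `f` in the open disc of radius `r` about `0`, with multiplicity. -/
def zeroCount (f : ℂ → ℂ) (r : ℝ) : ℝ≥0∞ :=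
  ∑' z : Metric.ball (0 : ℂ) r, ((analyticOrderAt f (z : ℂ) : ℕ∞) : ℝ≥0∞)

/-- The event that `Z_G (z W)` has a zero in the open disc of radius `r` about `0`. -/
def hasZeroEvent {V : Type u} [Fintype V] (G : SimpleGraph V) {Ω : Type v}
    (W : V → Ω → ℂ) (r : ℝ) : Set Ω :=
  {ω | ∃ z ∈ Metric.ball (0 : ℂ) r, partitionPoly G (fun x => W x ω) z = 0}

/-- `M = (1 + Δ) |V|`, where `Δ` is the maximum degree. -/
def sizeParam {V : Type u} [Fintype V] (G : SimpleGraph V) [DecidableRel G.Adj] : ℝ :=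
  (1 + (G.maxDegree : ℝ)) * (Fintype.card V : ℝ)

end Hardcore

end

/-! The second moment is an exact partition function. Write `|X_W(z)|²` as a sum over pairs of
independent sets `I`, `J`. By independence each expectation factorizes over vertices, and dividing
every vertex by `m = E e^{-2 Re(zw)}` leaves a two-layer hardcore model with weights `a`, `a'`, `b`
(`ofReal_secondMoment_eq`). Put `ρ = |z| L`, with `L` of order `K√ν` the exponential scale of the
weights. Because the weights are centered, `a` and `a'` are of order `ρ²`, like `b`.

For weights of order `ε` with `εΔ` small, deleting a vertex from a layer costs a relative error
`O(ε)`. So adding a vertex to both layers multiplies the partition function by `1 + a + a' + b` up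
to `O(Δε²)`. Edges thus contribute only `O(|V|Δρ⁴)` to the logarithm
(`twoLayer_univ_ne_zero_and_abs_log_sub_le`). What remains is `|V|` times the logarithm of the
edgeless moment `E|(1 + zw)e^{-zw}|² = m(1 + a + a' + b)`. Here `(1 + u)e^{-u} = 1 + g(u)` with `g`
holomorphic, `g(0) = 0` and `g = O(u²)`. In `|1 + g|² = 1 + 2 Re g + |g|²` the harmonic term
averages to zero over the circle, and a fourth-order term survives (`log_vertexMoment_bounds`).

For zeros, Jensen's formula bounds `2 N(r) log(R/r)` by the circle average of `log|X|²`. Concavity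
of the logarithm bounds the mean of that by the circle average of `log E|X|²`
(`exists_dominating_circleAverage`), and Markov's inequality gives the probability. The statements
on sequences follow by substitution, using `1 + Δ ≤ |V|`. -/

namespace Hardcore

/-! ### The two-layer hardcore model: comparison with the edgeless graph. -/

section TwoLayer

variable {V : Type u}

open Classical in
/-- The independent sets of `G` contained in `A`. -/
noncomputable def indepSubsets (G : SimpleGraph V) (A : Finset V) : Finset (Finset V) :=
  {I ∈ A.powerset | G.IsIndepSet (I : Set V)}

open Classical in
/-- The vertices of `A` that are different from `x` and not adjacent to it. -/
noncomputable def deleteClosedNbhd (G : SimpleGraph V) (x : V) (A : Finset V) : Finset V :=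
  {y ∈ A | y ≠ x ∧ ¬ G.Adj x y}

open Classical in
/-- Weight of a vertex that may be occupied in the first layer, in the second layer, or in both. -/
noncomputable def vertexWeight (a a' b : ℂ) (x : V) (I J : Finset V) : ℂ :=
  if x ∈ I then (if x ∈ J then b else a) else (if x ∈ J then a' else 1)

variable (G : SimpleGraph V)

theorem indepSubsets_empty : indepSubsets G ∅ = {∅} := by
  classical
  ext I
  simp only [indepSubsets, Finset.mem_filter, Finset.mem_powerset, Finset.subset_empty,
    Finset.mem_singleton, and_iff_left_iff_imp]
  rintro rfl
  simp

-- Split according to whether `x ∈ I`; removing `x` from a set that contains it leaves an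
-- independent set avoiding the closed neighbourhood of `x`.
open Classical in
theorem sum_indepSubsets {x : V} {A : Finset V} (hx : x ∈ A) (g : Finset V → ℂ) :
    ∑ I ∈ indepSubsets G A, g I =
      ∑ I ∈ indepSubsets G (A.erase x), g I +
        ∑ I ∈ indepSubsets G (deleteClosedNbhd G x A), g (insert x I) := by
  have h1 : (indepSubsets G A).filter (fun I => x ∉ I) = indepSubsets G (A.erase x) := by
    ext I
    simp only [indepSubsets, Finset.mem_filter, Finset.mem_powerset, Finset.subset_erase]
    tauto
  have h2 : (indepSubsets G A).filter (fun I => ¬ x ∉ I) =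
      (indepSubsets G (deleteClosedNbhd G x A)).image (insert x) := by
    ext I
    simp only [indepSubsets, deleteClosedNbhd, Finset.mem_filter, Finset.mem_powerset,
      Finset.mem_image, not_not]
    constructor
    · rintro ⟨⟨hI, hind⟩, hxI⟩
      refine ⟨I.erase x, ⟨fun y hy => ?_, ?_⟩, Finset.insert_erase hxI⟩
      · rw [Finset.mem_erase] at hy
        rw [Finset.mem_filter]
        exact ⟨hI hy.2, hy.1, hind hxI hy.2 (Ne.symm hy.1)⟩
      · exact hind.mono (by simp)
    · rintro ⟨I', ⟨hI', hind⟩, rfl⟩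
      refine ⟨⟨?_, ?_⟩, Finset.mem_insert_self _ _⟩
      · refine Finset.insert_subset hx (hI'.trans (Finset.filter_subset _ _))
      · rw [SimpleGraph.isIndepSet_iff, Finset.coe_insert,
          Set.pairwise_insert]
        refine ⟨hind, fun y hy _ => ?_⟩
        have h := (Finset.mem_filter.1 (hI' hy)).2.2
        exact ⟨h, fun h' => h h'.symm⟩
  rw [← Finset.sum_filter_add_sum_filter_not _ (fun I => x ∉ I), h1, h2, Finset.sum_image]
  intro I hI J hJ h
  have hn : ∀ I ∈ (indepSubsets G (deleteClosedNbhd G x A) : Set (Finset V)), x ∉ I := by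
    intro I hI hx
    simp only [indepSubsets, deleteClosedNbhd, Finset.coe_filter, Set.mem_ofPred_eq,
      Finset.mem_powerset] at hI
    exact (Finset.mem_filter.1 (hI.1 hx)).2.1 rfl
  rw [← Finset.erase_insert (hn I hI), h, Finset.erase_insert (hn J hJ)]

theorem notMem_of_mem_indepSubsets {x : V} {A I : Finset V} (hI : I ∈ indepSubsets G A)
    (hx : x ∉ A) : x ∉ I := by
  classical
  exact fun h => hx (Finset.mem_powerset.1 (Finset.mem_filter.1 hI).1 h)

theorem notMem_deleteClosedNbhd (x : V) (A : Finset V) : x ∉ deleteClosedNbhd G x A := by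
  classical
  simp [deleteClosedNbhd]

/-- `z` and `z'` agree up to a relative error of `m` steps of size `t`. -/
def RelClose (t : ℝ) (m : ℕ) (z' z : ℂ) : Prop := ‖z' - z‖ ≤ ((1 + t) ^ m - 1) * ‖z‖

theorem RelClose.refl {t : ℝ} (z : ℂ) : RelClose t 0 z z := by simp [RelClose]

theorem RelClose.norm_le {t : ℝ} {m : ℕ} {z' z : ℂ} (h : RelClose t m z' z) :
    ‖z'‖ ≤ (1 + t) ^ m * ‖z‖ := by
  have := norm_le_norm_add_norm_sub' z' z
  unfold RelClose at h
  linarith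

/-- Relative errors compound exactly: `((1+t)^m - 1)(1+t)^k + (1+t)^k - 1 = (1+t)^(m+k) - 1`. This
is why closeness is measured by `(1+t)^m - 1` and not by `m t`. -/
theorem RelClose.trans {t : ℝ} (ht : 0 ≤ t) {m k : ℕ} {x y z : ℂ} (h1 : RelClose t m x y)
    (h2 : RelClose t k y z) : RelClose t (m + k) x z := by
  have h3 := h2.norm_le
  unfold RelClose at *
  have h4 : 0 ≤ (1 + t) ^ m - 1 := sub_nonneg.2 (one_le_pow₀ (by linarith))
  calc ‖x - z‖ ≤ ‖x - y‖ + ‖y - z‖ := norm_sub_le_norm_sub_add_norm_sub _ _ _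
    _ ≤ ((1 + t) ^ m - 1) * ((1 + t) ^ k * ‖z‖) + ((1 + t) ^ k - 1) * ‖z‖ := by
      refine add_le_add (h1.trans ?_) h2
      gcongr
    _ = _ := by rw [pow_add]; ring

theorem RelClose.mono {t : ℝ} (ht : 0 ≤ t) {m k : ℕ} (hmk : m ≤ k) {x y : ℂ}
    (h : RelClose t m x y) : RelClose t k x y := by
  unfold RelClose at *
  refine h.trans ?_
  gcongr
  linarith

open Classical in
/-- Removing several vertices from the first layer, given control of each single removal. -/
theorem RelClose.sdiff {t : ℝ} (ht : 0 ≤ t) (f : Finset V → ℂ) {A : Finset V}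
    (h : ∀ A' ⊆ A, ∀ x ∈ A', RelClose t 1 (f (A'.erase x)) (f A')) (D : Finset V) (hD : D ⊆ A) :
    RelClose t D.card (f (A \ D)) (f A) := by
  induction D using Finset.induction_on with
  | empty => simpa using RelClose.refl _
  | insert x D hx ih =>
    rw [Finset.card_insert_of_notMem hx, add_comm, Finset.sdiff_insert]
    refine RelClose.trans ht (h _ Finset.sdiff_subset x ?_)
      (ih ((Finset.subset_insert _ _).trans hD))
    simp [hx, hD (Finset.mem_insert_self x D)]

theorem one_add_pow_sub_one_le {t : ℝ} (ht : 0 ≤ t) {m : ℕ} (hm : m * t ≤ 1) :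
    (1 + t) ^ m - 1 ≤ 2 * (m * t) := by
  have h1 : (1 + t) ^ m ≤ Real.exp (m * t) := by
    rw [Real.exp_nat_mul]
    exact pow_le_pow_left₀ (by linarith) (by linarith [Real.add_one_le_exp t]) m
  have h0 : 0 ≤ m * t := by positivity
  have h2 := Real.abs_exp_sub_one_le (x := m * t) (by rwa [abs_of_nonneg h0])
  rw [abs_of_nonneg h0] at h2
  linarith [le_abs_self (Real.exp (m * t) - 1)]

theorem deleteClosedNbhd_subset (x : V) (A : Finset V) : deleteClosedNbhd G x A ⊆ A := by
  classical
  exact Finset.filter_subset _ _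

open Classical in
theorem deleteClosedNbhd_erase (x : V) (A : Finset V) :
    deleteClosedNbhd G x (A.erase x) = deleteClosedNbhd G x A := by
  ext y
  simp only [deleteClosedNbhd, Finset.mem_filter, Finset.mem_erase]
  tauto

variable [Fintype V]

/-- The two-layer hardcore partition function: a sum over pairs of independent sets `I ⊆ A`,
`J ⊆ B`, with weights `a`, `a'`, `b` for a vertex in `I` only, in `J` only, or in both. -/
noncomputable def twoLayer (G : SimpleGraph V) (a a' b : ℂ) (A B : Finset V) : ℂ :=
  ∑ I ∈ indepSubsets G A, ∑ J ∈ indepSubsets G B, ∏ x, vertexWeight a a' b x I J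

open Classical in
theorem prod_vertexWeight_insert_left (a a' b : ℂ) {x : V} {I J : Finset V} (hI : x ∉ I)
    (hJ : x ∉ J) :
    ∏ y, vertexWeight a a' b y (insert x I) J = a * ∏ y, vertexWeight a a' b y I J := by
  rw [← Finset.mul_prod_erase _ _ (Finset.mem_univ x),
    ← Finset.mul_prod_erase _ (fun y => vertexWeight a a' b y I J) (Finset.mem_univ x)]
  have : ∏ y ∈ Finset.univ.erase x, vertexWeight a a' b y (insert x I) J =
      ∏ y ∈ Finset.univ.erase x, vertexWeight a a' b y I J := by
    refine Finset.prod_congr rfl fun y hy => ?_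
    simp [vertexWeight, Finset.ne_of_mem_erase hy]
  rw [this]
  simp [vertexWeight, hI, hJ]

open Classical in
theorem prod_vertexWeight_insert_both (a a' b : ℂ) {x : V} {I J : Finset V} (hI : x ∉ I)
    (hJ : x ∉ J) :
    ∏ y, vertexWeight a a' b y (insert x I) (insert x J) =
      b * ∏ y, vertexWeight a a' b y I J := by
  rw [← Finset.mul_prod_erase _ _ (Finset.mem_univ x),
    ← Finset.mul_prod_erase _ (fun y => vertexWeight a a' b y I J) (Finset.mem_univ x)]
  have : ∏ y ∈ Finset.univ.erase x, vertexWeight a a' b y (insert x I) (insert x J) =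
      ∏ y ∈ Finset.univ.erase x, vertexWeight a a' b y I J := by
    refine Finset.prod_congr rfl fun y hy => ?_
    simp [vertexWeight, Finset.ne_of_mem_erase hy]
  rw [this]
  simp [vertexWeight, hI, hJ]

/-- Lets every estimate on deletions from the first layer serve for the second, with `a` and `a'`
exchanged. -/
theorem twoLayer_swap (a a' b : ℂ) (A B : Finset V) :
    twoLayer G a a' b A B = twoLayer G a' a b B A := by
  classical
  rw [twoLayer, Finset.sum_comm]
  refine Finset.sum_congr rfl fun J _ => Finset.sum_congr rfl fun I _ =>
    Finset.prod_congr rfl fun x _ => ?_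
  by_cases h1 : x ∈ I <;> by_cases h2 : x ∈ J <;> simp [vertexWeight, h1, h2]

theorem twoLayer_empty (a a' b : ℂ) : twoLayer G a a' b ∅ ∅ = 1 := by
  simp [twoLayer, indepSubsets_empty, vertexWeight]

-- If `x` is occupied in the first layer, the second layer either omits it (weight `a`) or contains
-- it too (weight `b`), and then loses its closed neighbourhood as well.
open Classical in
theorem twoLayer_erase_left (a a' b : ℂ) {x : V} {A B : Finset V} (hx : x ∈ A) (hB : x ∈ B) :
    twoLayer G a a' b A B = twoLayer G a a' b (A.erase x) B +
      (a * twoLayer G a a' b (deleteClosedNbhd G x A) (B.erase x) +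
        b * twoLayer G a a' b (deleteClosedNbhd G x A) (deleteClosedNbhd G x B)) := by
  conv_lhs => rw [twoLayer, sum_indepSubsets G hx]
  congr 1
  simp only [twoLayer, Finset.mul_sum, ← Finset.sum_add_distrib]
  refine Finset.sum_congr rfl fun I hI => ?_
  have hxI := notMem_of_mem_indepSubsets G hI (notMem_deleteClosedNbhd G x A)
  rw [sum_indepSubsets G hB]
  congr 1
  · refine Finset.sum_congr rfl fun J hJ => prod_vertexWeight_insert_left _ _ _ hxI ?_
    exact notMem_of_mem_indepSubsets G hJ (by simp)
  · refine Finset.sum_congr rfl fun J hJ => prod_vertexWeight_insert_both _ _ _ hxI ?_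
    exact notMem_of_mem_indepSubsets G hJ (notMem_deleteClosedNbhd G x B)

open Classical in
theorem twoLayer_erase_left_of_notMem (a a' b : ℂ) {x : V} {A B : Finset V} (hx : x ∈ A)
    (hB : x ∉ B) :
    twoLayer G a a' b A B = twoLayer G a a' b (A.erase x) B +
      a * twoLayer G a a' b (deleteClosedNbhd G x A) B := by
  conv_lhs => rw [twoLayer, sum_indepSubsets G hx]
  congr 1
  simp only [twoLayer, Finset.mul_sum]
  refine Finset.sum_congr rfl fun I hI => ?_
  have hxI := notMem_of_mem_indepSubsets G hI (notMem_deleteClosedNbhd G x A)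
  exact Finset.sum_congr rfl fun J hJ => prod_vertexWeight_insert_left _ _ _ hxI
    (notMem_of_mem_indepSubsets G hJ hB)

-- Since `x ∉ A`, only neighbours of `x` are lost, hence `D` and not `D + 1`.
open Classical in
theorem card_sdiff_deleteClosedNbhd {D : ℕ} (hD : ∀ x, (Finset.univ.filter (G.Adj x)).card ≤ D)
    (x : V) (A : Finset V) (hx : x ∉ A) : (A \ deleteClosedNbhd G x A).card ≤ D := by
  refine (Finset.card_le_card fun y hy => ?_).trans (hD x)
  simp only [deleteClosedNbhd, Finset.mem_sdiff, Finset.mem_filter, not_and, not_not] at hy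
  simp only [Finset.mem_filter, Finset.mem_univ, true_and]
  exact hy.2 hy.1 (fun h => hx (h ▸ hy.1))

open Classical in
/-- Removing vertices from both layers, given control of each single removal. -/
theorem relClose_twoLayer_of_subset {t : ℝ} (ht : 0 ≤ t) {a a' b : ℂ} {A B : Finset V}
    (hl : ∀ A' ⊆ A, ∀ B' ⊆ B, ∀ x ∈ A',
      RelClose t 1 (twoLayer G a a' b (A'.erase x) B') (twoLayer G a a' b A' B'))
    (hr : ∀ A' ⊆ A, ∀ B' ⊆ B, ∀ x ∈ B',
      RelClose t 1 (twoLayer G a' a b (B'.erase x) A') (twoLayer G a' a b B' A'))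
    {A' B' : Finset V} (hA : A' ⊆ A) (hB : B' ⊆ B) :
    RelClose t ((A \ A').card + (B \ B').card) (twoLayer G a a' b A' B')
      (twoLayer G a a' b A B) := by
  have h1 := RelClose.sdiff ht (fun S => twoLayer G a a' b S B')
    (fun S hS x hx => hl S hS B' hB x hx) (A \ A') Finset.sdiff_subset
  have h2 := RelClose.sdiff ht (fun S => twoLayer G a' a b S A)
    (fun S hS x hx => hr A subset_rfl S hS x hx) (B \ B') Finset.sdiff_subset
  simp only [Finset.sdiff_sdiff_eq_self hA, Finset.sdiff_sdiff_eq_self hB] at h1 h2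
  rw [twoLayer_swap G a' a b B' A, twoLayer_swap G a' a b B A] at h2
  exact h1.trans ht h2

open Classical in
/-- Removing one vertex from one layer changes the two-layer partition function by a relative
error of order `ε`, in the regime `ε D ≪ 1`. -/
theorem relClose_twoLayer_erase {D : ℕ} (hD : ∀ x, (Finset.univ.filter (G.Adj x)).card ≤ D)
    {ε : ℝ} (hε : (2 * D + 1) * (4 * ε) ≤ 1 / 2) (k : ℕ) :
    ∀ a a' b : ℂ, ‖a‖ + ‖b‖ ≤ ε → ‖a'‖ + ‖b‖ ≤ ε → ∀ A B : Finset V, A.card + B.card ≤ k →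
      ∀ x ∈ A, RelClose (4 * ε) 1 (twoLayer G a a' b (A.erase x) B) (twoLayer G a a' b A B) := by
  -- The weights stay quantified because deletions from the second layer call the hypothesis with
  -- `a` and `a'` exchanged.
  induction k with
  | zero =>
    intro a a' b _ _ A B hk x hx
    have := Finset.card_pos.2 ⟨x, hx⟩
    omega
  | succ k ih =>
    intro a a' b hab hab' A B hk x hx
    have hε0 : 0 ≤ ε := (by positivity : 0 ≤ ‖a‖ + ‖b‖).trans hab
    have ht : 0 ≤ 4 * ε := by linarith
    have hcard := Finset.card_erase_add_one hx
    -- With `x` gone from the first layer, the induction hypothesis covers all further deletions.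
    -- There are at most `D + (D + 1)` of them, `x` itself possibly being deleted from `B`, and `(1
    -- + 4ε)^(2D+1) ≤ 1 + 2 · (1/2) = 2`.
    have key : ∀ A' ⊆ A.erase x, ∀ B' ⊆ B, (A.erase x \ A').card ≤ D → (B \ B').card ≤ D + 1 →
        ‖twoLayer G a a' b A' B'‖ ≤ 2 * ‖twoLayer G a a' b (A.erase x) B‖ := by
      intro A' hA' B' hB' h1 h2
      have h := (relClose_twoLayer_of_subset G ht (a := a) (a' := a') (b := b)
        (A := A.erase x) (B := B)
        (fun S hS T hT y hy => ih a a' b hab hab' S T (by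
          have := Finset.card_le_card hS
          have := Finset.card_le_card hT
          omega) y hy)
        (fun S hS T hT y hy => ih a' a b hab' hab T S (by
          have := Finset.card_le_card hS
          have := Finset.card_le_card hT
          omega) y hy) hA' hB').mono ht (k := 2 * D + 1) (by omega)
      refine h.norm_le.trans ?_
      have h3 := one_add_pow_sub_one_le ht (m := 2 * D + 1) (by push_cast; linarith)
      push_cast at h3
      gcongr
      linarith
    have hsubA : deleteClosedNbhd G x A ⊆ A.erase x := by
      rw [← deleteClosedNbhd_erase]
      exact deleteClosedNbhd_subset G x _
    have hcA : (A.erase x \ deleteClosedNbhd G x A).card ≤ D := by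
      rw [← deleteClosedNbhd_erase]
      exact card_sdiff_deleteClosedNbhd G hD x _ (by simp)
    have main : ‖twoLayer G a a' b (A.erase x) B - twoLayer G a a' b A B‖ ≤
        2 * ε * ‖twoLayer G a a' b (A.erase x) B‖ := by
      by_cases hB : x ∈ B
      · rw [twoLayer_erase_left G a a' b hx hB, sub_add_cancel_left, norm_neg]
        have hcB : (B.erase x \ deleteClosedNbhd G x B).card ≤ D := by
          rw [← deleteClosedNbhd_erase]
          exact card_sdiff_deleteClosedNbhd G hD x _ (by simp)
        have e1 := key _ hsubA (B.erase x) (Finset.erase_subset _ _) hcA (by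
          rw [Finset.sdiff_erase_self hB]; simp)
        have e2 := key _ hsubA _ (deleteClosedNbhd_subset G x B) hcA (by
          refine (Finset.card_le_card (t := insert x (B.erase x \ deleteClosedNbhd G x B))
            fun y hy => ?_).trans ((Finset.card_insert_le _ _).trans (by omega))
          simp only [Finset.mem_insert, Finset.mem_sdiff, Finset.mem_erase] at hy ⊢
          tauto)
        calc _ ≤ ‖a‖ * (2 * ‖twoLayer G a a' b (A.erase x) B‖) +
              ‖b‖ * (2 * ‖twoLayer G a a' b (A.erase x) B‖) := by
              refine (norm_add_le _ _).trans ?_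
              rw [norm_mul, norm_mul]
              gcongr
          _ = (‖a‖ + ‖b‖) * (2 * ‖twoLayer G a a' b (A.erase x) B‖) := by ring
          _ ≤ ε * (2 * ‖twoLayer G a a' b (A.erase x) B‖) := by gcongr
          _ = _ := by ring
      · rw [twoLayer_erase_left_of_notMem G a a' b hx hB, sub_add_cancel_left, norm_neg, norm_mul]
        have e1 := key _ hsubA B subset_rfl hcA (by simp)
        calc _ ≤ ‖a‖ * (2 * ‖twoLayer G a a' b (A.erase x) B‖) := by gcongr
          _ ≤ ε * (2 * ‖twoLayer G a a' b (A.erase x) B‖) := by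
            gcongr
            linarith [norm_nonneg b]
          _ = _ := by ring
    -- The error so far is `2ε` relative to the value after deletion. That value is at most twice
    -- the value before it, whence `4ε`.
    have hD0 : (0 : ℝ) ≤ D := by positivity
    have hε8 : ε ≤ 1 / 8 := by nlinarith
    have h5 := norm_le_norm_add_norm_sub' (twoLayer G a a' b (A.erase x) B)
      (twoLayer G a a' b A B)
    unfold RelClose
    have h6 := norm_nonneg (twoLayer G a a' b (A.erase x) B)
    have h7 : 2 * ε * ‖twoLayer G a a' b (A.erase x) B‖ ≤
        1 / 4 * ‖twoLayer G a a' b (A.erase x) B‖ := by gcongr; linarith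
    have h8 : ‖twoLayer G a a' b (A.erase x) B‖ ≤ 2 * ‖twoLayer G a a' b A B‖ := by linarith
    have h9 : 2 * ε * ‖twoLayer G a a' b (A.erase x) B‖ ≤
        2 * ε * (2 * ‖twoLayer G a a' b A B‖) := by gcongr
    linarith

open Classical in
/-- In the regime `ε D ≪ 1`, the two-layer partition function is nonzero, and its logarithm is
that of the edgeless graph up to an error of order `|V| D ε²`. -/
theorem twoLayer_univ_ne_zero_and_abs_log_sub_le {D : ℕ}
    (hD : ∀ x, (Finset.univ.filter (G.Adj x)).card ≤ D)
    {ε : ℝ} (hε : (2 * D + 1) * (4 * ε) ≤ 1 / 2) {a a' b : ℂ} (hab : ‖a‖ + ‖b‖ ≤ ε)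
    (hab' : ‖a'‖ + ‖b‖ ≤ ε) :
    twoLayer G a a' b Finset.univ Finset.univ ≠ 0 ∧
      |Real.log ‖twoLayer G a a' b Finset.univ Finset.univ‖ -
        Fintype.card V * Real.log ‖1 + a + a' + b‖| ≤ Fintype.card V * (128 * D * ε ^ 2) := by
  classical
  have hε0 : 0 ≤ ε := (by positivity : 0 ≤ ‖a‖ + ‖b‖).trans hab
  have ht : 0 ≤ 4 * ε := by linarith
  have hD0 : (0 : ℝ) ≤ D := by positivity
  have hε8 : ε ≤ 1 / 8 := by nlinarith
  have hclose : ∀ {A B A' B' : Finset V}, A' ⊆ A → B' ⊆ B →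
      RelClose (4 * ε) ((A \ A').card + (B \ B').card) (twoLayer G a a' b A' B')
        (twoLayer G a a' b A B) := fun {A B A' B'} hA hB =>
    relClose_twoLayer_of_subset G ht
      (fun S _ T _ y hy => relClose_twoLayer_erase G hD hε _ a a' b hab hab' S T le_rfl y hy)
      (fun S _ T _ y hy => relClose_twoLayer_erase G hD hε _ a' a b hab' hab T S le_rfl y hy)
      hA hB
  -- Deleting everything leaves `1`, which cannot be relatively close to `0`.
  have hne : ∀ A B : Finset V, twoLayer G a a' b A B ≠ 0 := by
    intro A B h0
    have := (hclose (A' := ∅) (B' := ∅) (Finset.empty_subset A) (Finset.empty_subset B)).norm_le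
    rw [twoLayer_empty, h0] at this
    norm_num at this
  refine ⟨hne _ _, ?_⟩
  have hh : 1 / 2 ≤ ‖1 + a + a' + b‖ := by
    have h1 : ‖(1 : ℂ)‖ ≤ ‖1 + a + a' + b‖ + ‖a + a' + b‖ := by
      have := norm_sub_le (1 + a + a' + b) (a + a' + b)
      rwa [show 1 + a + a' + b - (a + a' + b) = 1 by ring] at this
    have h2 : ‖a + a' + b‖ ≤ ‖a‖ + ‖a'‖ + ‖b‖ := norm_add₃_le
    have := norm_nonneg b
    rw [norm_one] at h1
    linarith
  -- Adding `x` to both layers contributes terms of weight `O(ε)`, each evaluated with at most `D`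
  -- vertices missing per layer, so replacing them by the full value costs `O(ε · Dε)`. Constants:
  -- `2 · (2D · 4ε) = 16Dε` per term, total weight `2ε`, then a factor `2` from `‖1 + a + a' + b‖ ≥
  -- 1/2` and another `2` from the logarithm near `1`.
  have hstep : ∀ (A : Finset V) (x : V), x ∉ A →
      |Real.log ‖twoLayer G a a' b (insert x A) (insert x A)‖ - Real.log ‖twoLayer G a a' b A A‖ -
        Real.log ‖1 + a + a' + b‖| ≤ 128 * D * ε ^ 2 := by
    intro A x hx
    have hN : ∀ C : Finset V, C = insert x A → deleteClosedNbhd G x C = deleteClosedNbhd G x A := by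
      rintro C rfl
      rw [← deleteClosedNbhd_erase, Finset.erase_insert hx]
    set N := deleteClosedNbhd G x A with hNdef
    have hNA : N ⊆ A := deleteClosedNbhd_subset G x A
    have hNc : (A \ N).card ≤ D := card_sdiff_deleteClosedNbhd G hD x A hx
    -- `x` leaves the first layer here; next, with the layers exchanged, it leaves the second.
    have e1 := twoLayer_erase_left G a a' b (A := insert x A) (B := insert x A)
      (Finset.mem_insert_self x A) (Finset.mem_insert_self x A)
    have e2 := twoLayer_erase_left_of_notMem G a' a b (A := insert x A) (B := A)
      (Finset.mem_insert_self x A) hx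
    rw [Finset.erase_insert hx, hN _ rfl] at e1 e2
    rw [twoLayer_swap G a' a b _ A, twoLayer_swap G a' a b A A, twoLayer_swap G a' a b N A] at e2
    set Z := twoLayer G a a' b A A with hZ
    have hZ0 : 0 < ‖Z‖ := norm_pos_iff.2 (hne _ _)
    have hrel : ∀ A' ⊆ A, ∀ B' ⊆ A, (A \ A').card ≤ D → (A \ B').card ≤ D →
        ‖twoLayer G a a' b A' B' - Z‖ ≤ 16 * D * ε * ‖Z‖ := by
      intro A' hA B' hB h1 h2
      have h3 := (hclose hA hB).mono ht (k := 2 * D) (by omega)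
      have h4 := one_add_pow_sub_one_le ht (m := 2 * D) (by push_cast; nlinarith)
      push_cast at h4
      rw [RelClose] at h3
      refine h3.trans ?_
      gcongr
      linarith
    have hA0 : (A \ A).card ≤ D := by simp
    have r1 := hrel N hNA A subset_rfl hNc hA0
    have r2 := hrel A subset_rfl N hNA hA0 hNc
    have r3 := hrel N hNA N hNA hNc hNc
    set Z' := twoLayer G a a' b (insert x A) (insert x A) with hZ'
    have hZ'0 : 0 < ‖Z'‖ := norm_pos_iff.2 (hne _ _)
    have hdiff : ‖Z' - (1 + a + a' + b) * Z‖ ≤ 32 * D * ε ^ 2 * ‖Z‖ := by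
      have : Z' - (1 + a + a' + b) * Z = a * (twoLayer G a a' b N A - Z) +
          a' * (twoLayer G a a' b A N - Z) + b * (twoLayer G a a' b N N - Z) := by
        rw [e1, e2]; ring
      rw [this]
      calc _ ≤ ‖a‖ * (16 * D * ε * ‖Z‖) + ‖a'‖ * (16 * D * ε * ‖Z‖) +
            ‖b‖ * (16 * D * ε * ‖Z‖) := by
            refine norm_add₃_le.trans ?_
            rw [norm_mul, norm_mul, norm_mul]
            gcongr
        _ = (‖a‖ + ‖a'‖ + ‖b‖) * (16 * D * ε * ‖Z‖) := by ring
        _ ≤ (2 * ε) * (16 * D * ε * ‖Z‖) := by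
            gcongr
            linarith [norm_nonneg b]
        _ = _ := by ring
    set H := ‖1 + a + a' + b‖ with hH
    have hH0 : 0 < H := by linarith
    set y := ‖Z'‖ / (H * ‖Z‖) with hy
    have hy1 : |y - 1| ≤ 64 * D * ε ^ 2 := by
      have h1 : |‖Z'‖ - H * ‖Z‖| ≤ 32 * D * ε ^ 2 * ‖Z‖ := by
        rw [hH, ← norm_mul]
        exact (abs_norm_sub_norm_le _ _).trans hdiff
      have h2 : y - 1 = (‖Z'‖ - H * ‖Z‖) / (H * ‖Z‖) := by
        rw [hy]; field_simp
      rw [h2, abs_div, abs_of_pos (mul_pos hH0 hZ0), div_le_iff₀ (mul_pos hH0 hZ0)]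
      refine h1.trans ?_
      have : 0 ≤ 32 * D * ε ^ 2 * ‖Z‖ := by positivity
      nlinarith
    have hsmall : 64 * D * ε ^ 2 ≤ 1 / 2 := by nlinarith
    have hlog : Real.log ‖Z'‖ - Real.log ‖Z‖ - Real.log H = Real.log y := by
      rw [hy, Real.log_div hZ'0.ne' (by positivity), Real.log_mul hH0.ne' hZ0.ne']
      ring
    rw [hlog]
    rw [abs_le] at hy1 ⊢
    have hy0 : 1 / 2 ≤ y := by linarith
    constructor
    · have h1 := Real.one_sub_inv_le_log_of_pos (show 0 < y by linarith)
      have h2 : -(128 * D * ε ^ 2) ≤ 1 - y⁻¹ := by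
        have : 1 - y⁻¹ = (y - 1) / y := by field_simp
        rw [this, le_div_iff₀ (by linarith)]
        have : 0 ≤ 64 * D * ε ^ 2 := by positivity
        nlinarith
      linarith
    · have h1 := Real.log_le_sub_one_of_pos (show 0 < y by linarith)
      have : 0 ≤ 64 * D * ε ^ 2 := by positivity
      linarith
  have hall : ∀ A : Finset V, |Real.log ‖twoLayer G a a' b A A‖ -
      A.card * Real.log ‖1 + a + a' + b‖| ≤ A.card * (128 * D * ε ^ 2) := by
    intro A
    induction A using Finset.induction_on with
    | empty => simp [twoLayer_empty]
    | insert x A hx ih =>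
      have h := hstep A x hx
      rw [Finset.card_insert_of_notMem hx]
      push_cast
      rw [abs_le] at *
      constructor <;> nlinarith
  simpa using hall Finset.univ

end TwoLayer

/-! ### Circle averages: integrability, Fubini and logarithms near `1`. -/

section CircleAverage

theorem norm_mem_of_mem_sphere {R : ℝ} (hR : 0 ≤ R) {z : ℂ} (hz : z ∈ Metric.sphere (0 : ℂ) |R|) :
    ‖z‖ = R := by
  simpa [abs_of_nonneg hR] using hz

/-- A measurable function that is bounded on a circle is integrable over it. -/
theorem circleIntegrable_of_abs_le {R : ℝ} (hR : 0 ≤ R) {f : ℂ → ℝ} (hf : Measurable f) {C : ℝ}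
    (hC : ∀ z : ℂ, ‖z‖ = R → |f z| ≤ C) : CircleIntegrable f 0 R := by
  refine IntervalIntegrable.mono_fun' (g := fun _ => C) intervalIntegrable_const
    (hf.comp (continuous_circleMap 0 R).measurable).aestronglyMeasurable
    (Eventually.of_forall fun θ => ?_)
  exact hC _ (by simp [abs_of_nonneg hR])

/-- Circle averages and expectations commute for a dominated function. -/
theorem circleAverage_integral_swap {Ω : Type*} [MeasurableSpace Ω] {P : Measure Ω} [SFinite P]
    {R : ℝ} (hR : 0 ≤ R) {f : ℂ → Ω → ℝ} (hf : Measurable (Function.uncurry f)) {g : Ω → ℝ}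
    (hg : Integrable g P) (hfg : ∀ z : ℂ, ‖z‖ = R → ∀ ω, |f z ω| ≤ g ω) :
    Real.circleAverage (fun z => ∫ ω, f z ω ∂P) 0 R =
      ∫ ω, Real.circleAverage (fun z => f z ω) 0 R ∂P := by
  simp only [Real.circleAverage_def, smul_eq_mul]
  rw [integral_const_mul]
  congr 1
  refine intervalIntegral_integral_swap (f := fun θ ω => f (circleMap 0 R θ) ω) ?_
  have : IsFiniteMeasure ((volume : Measure ℝ).restrict (Set.uIoc 0 (2 * Real.pi))) :=
    ⟨by simp [Set.uIoc]⟩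
  have h1 : Integrable (fun p : ℝ × Ω => g p.2)
      ((volume.restrict (Set.uIoc 0 (2 * Real.pi))).prod P) := hg.comp_snd _
  refine h1.mono' ?_ (Eventually.of_forall fun p => ?_)
  · have h2 : Measurable (fun p : ℝ × Ω => (circleMap 0 R p.1, p.2)) :=
      ((continuous_circleMap 0 R).measurable.comp measurable_fst).prodMk measurable_snd
    exact (hf.comp h2).aestronglyMeasurable
  · exact hfg _ (by simp [abs_of_nonneg hR]) _

/-- As `log t = t - 1 + O((t - 1)²)`, any cancellation in the average of `f - 1` is inherited by
`log f`, up to the square of the uniform bound `η`. -/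
theorem circleAverage_log_le_of_abs_sub_one_le {R : ℝ} (hR : 0 ≤ R) {f : ℂ → ℝ}
    (hf : Measurable f) {η : ℝ} (hη : η ≤ 1 / 2) (h : ∀ z : ℂ, ‖z‖ = R → |f z - 1| ≤ η) :
    CircleIntegrable (fun z => Real.log (f z)) 0 R ∧
      (∀ z : ℂ, ‖z‖ = R → |Real.log (f z)| ≤ 2 * η) ∧
    |Real.circleAverage (fun z => Real.log (f z)) 0 R| ≤
      |Real.circleAverage f 0 R - 1| + 2 * η ^ 2 := by
  have hlog : ∀ z : ℂ, ‖z‖ = R → |Real.log (f z) - (f z - 1)| ≤ 2 * η ^ 2 := by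
    intro z hz
    have h0 := h z hz
    have h1 := abs_le.1 h0
    have hpos : 1 / 2 ≤ f z := by linarith
    have h2 := Real.one_sub_inv_le_log_of_pos (show 0 < f z by linarith)
    have h3 := Real.log_le_sub_one_of_pos (show 0 < f z by linarith)
    have h4 : (f z - 1) ^ 2 ≤ η ^ 2 := sq_le_sq' (by linarith) h1.2
    have h5 : 1 - (f z)⁻¹ - (f z - 1) = - ((f z - 1) ^ 2 / f z) := by
      field_simp
      ring
    have h6 : (f z - 1) ^ 2 / f z ≤ 2 * η ^ 2 := by
      rw [div_le_iff₀ (by linarith)]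
      nlinarith [sq_nonneg η]
    rw [abs_le]
    constructor <;> linarith [sq_nonneg η]
  have hη0 : ∀ z : ℂ, ‖z‖ = R → |Real.log (f z)| ≤ 2 * η := by
    intro z hz
    have h1 := hlog z hz
    have h2 := h z hz
    have h3 := abs_add_le (Real.log (f z) - (f z - 1)) (f z - 1)
    rw [sub_add_cancel] at h3
    have h4 : 0 ≤ η := (abs_nonneg _).trans h2
    nlinarith
  have i1 : CircleIntegrable (fun z => Real.log (f z)) 0 R :=
    circleIntegrable_of_abs_le hR hf.log hη0
  have i2 : CircleIntegrable f 0 R := by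
    refine circleIntegrable_of_abs_le (C := 1 + η) hR hf fun z hz => ?_
    have h1 := abs_le.1 (h z hz)
    rw [abs_le]
    constructor <;> linarith
  have i3 : CircleIntegrable (fun _ => (1 : ℝ)) (0 : ℂ) R := circleIntegrable_const _ _ _
  have i4 : CircleIntegrable (fun z => f z - 1) 0 R := i2.sub i3
  refine ⟨i1, hη0, ?_⟩
  have e1 : Real.circleAverage (fun z => Real.log (f z) - (f z - 1)) 0 R =
      Real.circleAverage (fun z => Real.log (f z)) 0 R - (Real.circleAverage f 0 R - 1) := by
    rw [Real.circleAverage_fun_sub i1 i4, Real.circleAverage_fun_sub i2 i3,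
      Real.circleAverage_const]
  have e2 : |Real.circleAverage (fun z => Real.log (f z) - (f z - 1)) 0 R| ≤ 2 * η ^ 2 := by
    refine Real.abs_circleAverage_le_circleAverage_abs.trans ?_
    refine Real.circleAverage_mono_on_of_le_circle (i1.sub i4).abs fun z hz => ?_
    exact hlog z (norm_mem_of_mem_sphere hR hz)
  rw [e1] at e2
  have h3 := abs_add_le (Real.circleAverage (fun z => Real.log (f z)) 0 R -
    (Real.circleAverage f 0 R - 1)) (Real.circleAverage f 0 R - 1)
  rw [sub_add_cancel] at h3
  linarith

end CircleAverage

/-! ### Elementary bounds for `(1 + u) e^{-u}`. -/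

section ExpBounds

/-- Half of the exponential moment pays for a polynomial factor; `8 = 2! · 2²`, and below `384 = 4!
· 2⁴`. -/
theorem sq_le_mul_exp {x : ℝ} (hx : 0 ≤ x) : x ^ 2 ≤ 8 * Real.exp (x / 2) := by
  have := Real.pow_div_factorial_le_exp (x / 2) (by positivity) 2
  norm_num [Nat.factorial] at this
  linarith

theorem pow_four_le_mul_exp {x : ℝ} (hx : 0 ≤ x) : x ^ 4 ≤ 384 * Real.exp (x / 2) := by
  have := Real.pow_div_factorial_le_exp (x / 2) (by positivity) 4
  norm_num [Nat.factorial] at this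
  linarith

/-- `(1 + u) e^{-u}`, the reweighting of a single vertex. -/
noncomputable def primaryFactor (u : ℂ) : ℂ := (1 + u) * Complex.exp (-u)

/-- The linear term cancels: `(1 + u)e^{-u} - 1 = -(e^u - 1 - u)e^{-u}`. -/
theorem norm_primaryFactor_sub_one_le (u : ℂ) :
    ‖primaryFactor u - 1‖ ≤ ‖u‖ ^ 2 * Real.exp (2 * ‖u‖) := by
  have h1 := Complex.norm_exp_sub_sum_le_norm_mul_exp u 2
  simp only [Finset.sum_range_succ, Finset.sum_range_zero, Nat.factorial] at h1
  norm_num at h1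
  have h2 : primaryFactor u - 1 = -(Complex.exp u - (1 + u)) * Complex.exp (-u) := by
    have : Complex.exp u * Complex.exp (-u) = 1 := by rw [← Complex.exp_add]; simp
    rw [primaryFactor]
    linear_combination this
  have h3 : ‖Complex.exp (-u)‖ ≤ Real.exp ‖u‖ := by
    simpa using Complex.norm_exp_le_exp_norm (-u)
  rw [h2, norm_mul, norm_neg, two_mul, Real.exp_add, ← mul_assoc]
  gcongr

/-- Isolates the harmonic term, which disappears on averaging over a circle, from a remainder of
fourth order. -/
theorem sq_norm_primaryFactor (u : ℂ) :
    ‖primaryFactor u‖ ^ 2 =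
      1 + 2 * (primaryFactor u - 1).re + ‖primaryFactor u - 1‖ ^ 2 := by
  rw [← Complex.normSq_eq_norm_sq, ← Complex.normSq_eq_norm_sq, Complex.normSq_apply,
    Complex.normSq_apply]
  simp only [Complex.sub_re, Complex.one_re, Complex.sub_im, Complex.one_im]
  ring

theorem sq_norm_primaryFactor_eq (u : ℂ) :
    ‖primaryFactor u‖ ^ 2 = Real.exp (-2 * u.re) + 2 * (u * Real.exp (-2 * u.re)).re +
      ‖u‖ ^ 2 * Real.exp (-2 * u.re) := by
  have h : ‖Complex.exp (-u)‖ ^ 2 = Real.exp (-2 * u.re) := by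
    rw [Complex.norm_exp, ← Real.exp_nat_mul]
    simp
  rw [primaryFactor, norm_mul, mul_pow, h, Complex.re_mul_ofReal]
  rw [← Complex.normSq_eq_norm_sq, ← Complex.normSq_eq_norm_sq, Complex.normSq_apply,
    Complex.normSq_apply]
  simp only [Complex.add_re, Complex.one_re, Complex.add_im, Complex.one_im]
  ring

end ExpBounds

/-- A centered probability measure on `ℂ` whose norm has an exponential moment at scale `L`. -/
structure IsCenteredSubexp (μ : Measure ℂ) (L : ℝ) : Prop where
  pos : 0 < L
  integrable_exp : Integrable (fun w : ℂ => Real.exp (‖w‖ / L)) μ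
  integral_exp_le : ∫ w, Real.exp (‖w‖ / L) ∂μ ≤ 2
  mean_zero : ∫ w, w ∂μ = 0

/-! ### Tilted moments of one weight and the single-vertex second moment. -/

section SingleVertex

variable (μ : Measure ℂ)

/-- `E e^{-2 Re (z w)}`. -/
noncomputable def tiltMass (z : ℂ) : ℝ := ∫ w, Real.exp (-2 * (z * w).re) ∂μ

/-- `E z w e^{-2 Re (z w)}`. -/
noncomputable def tiltMean (z : ℂ) : ℂ := ∫ w, z * w * Real.exp (-2 * (z * w).re) ∂μ

/-- `E |z w|² e^{-2 Re (z w)}`. -/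
noncomputable def tiltSq (z : ℂ) : ℝ := ∫ w, ‖z * w‖ ^ 2 * Real.exp (-2 * (z * w).re) ∂μ

/-- `E |(1 + z w) e^{-z w}|²`. -/
noncomputable def vertexMoment (z : ℂ) : ℝ := ∫ w, ‖primaryFactor (z * w)‖ ^ 2 ∂μ

variable {μ} {L : ℝ}

/-- Separates the small parameter `ρ = ‖z‖ L` from the variable `x = ‖w‖ / L`. All pointwise bounds
below have the form `C ρ^k e^x`, and `ρ ≤ 1/8` keeps the exponents within `x`. -/
theorem norm_mul_eq_div (hL : 0 < L) (z w : ℂ) : ‖z * w‖ = ‖z‖ * L * (‖w‖ / L) := by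
  rw [norm_mul]
  field_simp

theorem IsCenteredSubexp.integrable_of_norm_le {E : Type*} [NormedAddCommGroup E]
    (h : IsCenteredSubexp μ L) {f : ℂ → E} (hf : AEStronglyMeasurable f μ) {C : ℝ}
    (hC : ∀ w, ‖f w‖ ≤ C * Real.exp (‖w‖ / L)) : Integrable f μ :=
  (h.integrable_exp.const_mul C).mono' hf (Eventually.of_forall hC)

theorem IsCenteredSubexp.norm_integral_le {E : Type*} [NormedAddCommGroup E] [NormedSpace ℝ E]
    (h : IsCenteredSubexp μ L) {f : ℂ → E} {C : ℝ} (hC0 : 0 ≤ C)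
    (hC : ∀ w, ‖f w‖ ≤ C * Real.exp (‖w‖ / L)) : ‖∫ w, f w ∂μ‖ ≤ 2 * C := by
  refine (norm_integral_le_of_norm_le (h.integrable_exp.const_mul C)
    (Eventually.of_forall hC)).trans ?_
  rw [integral_const_mul]
  nlinarith [h.integral_exp_le]

theorem exp_tilt_le (hL : 0 < L) {z : ℂ} (w : ℂ) :
    Real.exp (-2 * (z * w).re) ≤ Real.exp (2 * (‖z‖ * L) * (‖w‖ / L)) := by
  have h1 := Complex.abs_re_le_norm (z * w)
  rw [norm_mul_eq_div hL] at h1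
  have h2 := neg_abs_le (z * w).re
  exact Real.exp_le_exp.2 (by linarith)

theorem sq_mul_exp_le {ρ c x : ℝ} (hx : 0 ≤ x) (hc : c ≤ 1 / 2) :
    (ρ * x) ^ 2 * Real.exp (c * x) ≤ 8 * ρ ^ 2 * Real.exp x := by
  have h1 : Real.exp (c * x) ≤ Real.exp (x / 2) := Real.exp_le_exp.2 (by nlinarith)
  calc (ρ * x) ^ 2 * Real.exp (c * x) ≤ (ρ ^ 2 * (8 * Real.exp (x / 2))) * Real.exp (x / 2) := by
        rw [mul_pow]
        gcongr
        exact sq_le_mul_exp hx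
    _ = 8 * ρ ^ 2 * (Real.exp (x / 2) * Real.exp (x / 2)) := by ring
    _ = _ := by rw [← Real.exp_add, add_halves]

theorem pow_four_mul_exp_le {ρ c x : ℝ} (hx : 0 ≤ x) (hc : c ≤ 1 / 2) :
    (ρ * x) ^ 4 * Real.exp (c * x) ≤ 384 * ρ ^ 4 * Real.exp x := by
  have h1 : Real.exp (c * x) ≤ Real.exp (x / 2) := Real.exp_le_exp.2 (by nlinarith)
  calc (ρ * x) ^ 4 * Real.exp (c * x) ≤
        (ρ ^ 4 * (384 * Real.exp (x / 2))) * Real.exp (x / 2) := by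
        rw [mul_pow]
        gcongr
        exact pow_four_le_mul_exp hx
    _ = 384 * ρ ^ 4 * (Real.exp (x / 2) * Real.exp (x / 2)) := by ring
    _ = _ := by rw [← Real.exp_add, add_halves]

variable {z : ℂ}

theorem exp_tilt_le_exp (hL : 0 < L) (hz : ‖z‖ * L ≤ 1 / 8) (w : ℂ) :
    Real.exp (-2 * (z * w).re) ≤ Real.exp (‖w‖ / L) := by
  refine (exp_tilt_le hL w).trans (Real.exp_le_exp.2 ?_)
  have : 0 ≤ ‖w‖ / L := by positivity
  nlinarith

theorem norm_mul_exp_tilt_le (hL : 0 < L) (hz : ‖z‖ * L ≤ 1 / 8) (w : ℂ) :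
    ‖z * w * Real.exp (-2 * (z * w).re)‖ ≤ 1 * Real.exp (‖w‖ / L) := by
  have h0 : 0 ≤ ‖w‖ / L := by positivity
  rw [norm_mul, Complex.norm_real, Real.norm_of_nonneg (Real.exp_pos _).le]
  have h1 : ‖z * w‖ ≤ Real.exp ‖z * w‖ := by linarith [Real.add_one_le_exp ‖z * w‖]
  calc _ ≤ Real.exp ‖z * w‖ * Real.exp (2 * (‖z‖ * L) * (‖w‖ / L)) := by
        exact mul_le_mul h1 (exp_tilt_le hL w) (Real.exp_pos _).le (Real.exp_pos _).le
    _ ≤ _ := by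
        rw [← Real.exp_add, one_mul, norm_mul_eq_div hL]
        exact Real.exp_le_exp.2 (by nlinarith)

theorem norm_mul_exp_tilt_sub_le (hL : 0 < L) (hz : ‖z‖ * L ≤ 1 / 8) (w : ℂ) :
    ‖z * w * Real.exp (-2 * (z * w).re) - z * w‖ ≤
      16 * (‖z‖ * L) ^ 2 * Real.exp (‖w‖ / L) := by
  have h0 : 0 ≤ ‖w‖ / L := by positivity
  have h1 := Complex.norm_exp_sub_sum_le_norm_mul_exp ((-2 * (z * w).re : ℝ) : ℂ) 1
  simp only [Finset.sum_range_one, pow_zero, Nat.factorial, pow_one, Complex.norm_real] at h1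
  rw [show (1 : ℂ) / ((1 : ℕ) : ℂ) = 1 by simp, ← Complex.ofReal_exp] at h1
  have h2 : ‖-2 * (z * w).re‖ ≤ 2 * ‖z * w‖ := by
    rw [norm_mul]
    have := Complex.abs_re_le_norm (z * w)
    simpa using this
  calc _ = ‖z * w‖ * ‖(Real.exp (-2 * (z * w).re) : ℂ) - 1‖ := by
        rw [← norm_mul]
        congr 1
        ring
    _ ≤ ‖z * w‖ * (2 * ‖z * w‖ * Real.exp (2 * ‖z * w‖)) := by
        gcongr
        refine h1.trans ?_
        gcongr
    _ = 2 * ((‖z‖ * L * (‖w‖ / L)) ^ 2 * Real.exp (2 * (‖z‖ * L) * (‖w‖ / L))) := by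
        rw [norm_mul_eq_div hL]
        ring_nf
    _ ≤ 2 * (8 * (‖z‖ * L) ^ 2 * Real.exp (‖w‖ / L)) := by
        exact mul_le_mul_of_nonneg_left (sq_mul_exp_le h0 (by linarith)) (by norm_num)
    _ = _ := by ring

theorem sq_norm_mul_exp_tilt_le (hL : 0 < L) (hz : ‖z‖ * L ≤ 1 / 8) (w : ℂ) :
    ‖z * w‖ ^ 2 * Real.exp (-2 * (z * w).re) ≤ 8 * (‖z‖ * L) ^ 2 * Real.exp (‖w‖ / L) := by
  refine le_trans ?_ (sq_mul_exp_le (ρ := ‖z‖ * L) (c := 2 * (‖z‖ * L)) (x := ‖w‖ / L)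
    (by positivity) (by linarith))
  rw [norm_mul_eq_div hL]
  exact mul_le_mul_of_nonneg_left (exp_tilt_le hL w) (by positivity)

theorem norm_primaryFactor_mul_sub_one_le (hL : 0 < L) (hz : ‖z‖ * L ≤ 1 / 8) (w : ℂ) :
    ‖primaryFactor (z * w) - 1‖ ≤ 8 * (‖z‖ * L) ^ 2 * Real.exp (‖w‖ / L) := by
  refine (norm_primaryFactor_sub_one_le _).trans ?_
  rw [norm_mul_eq_div hL, ← mul_assoc 2]
  exact sq_mul_exp_le (by positivity) (by linarith)

theorem sq_norm_primaryFactor_mul_sub_one_le (hL : 0 < L) (hz : ‖z‖ * L ≤ 1 / 8) (w : ℂ) :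
    ‖primaryFactor (z * w) - 1‖ ^ 2 ≤ 384 * (‖z‖ * L) ^ 4 * Real.exp (‖w‖ / L) := by
  have h := pow_le_pow_left₀ (norm_nonneg _) (norm_primaryFactor_sub_one_le (z * w)) 2
  refine h.trans ?_
  rw [mul_pow, ← pow_mul, ← Real.exp_nat_mul, norm_mul_eq_div hL]
  have := pow_four_mul_exp_le (ρ := ‖z‖ * L) (c := 4 * (‖z‖ * L)) (x := ‖w‖ / L)
    (by positivity) (by linarith)
  rw [show ((2 : ℕ) : ℝ) * (2 * (‖z‖ * L * (‖w‖ / L))) = 4 * (‖z‖ * L) * (‖w‖ / L) by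
    push_cast; ring]
  exact this

theorem abs_sq_norm_primaryFactor_sub_one_le (hL : 0 < L) (hz : ‖z‖ * L ≤ 1 / 8) (w : ℂ) :
    |‖primaryFactor (z * w)‖ ^ 2 - 1| ≤ 22 * (‖z‖ * L) ^ 2 * Real.exp (‖w‖ / L) := by
  have h1 := norm_primaryFactor_mul_sub_one_le hL hz w
  have h2 := sq_norm_primaryFactor_mul_sub_one_le hL hz w
  have h3 := Complex.abs_re_le_norm (primaryFactor (z * w) - 1)
  have h0 : 0 ≤ ‖z‖ * L := by positivity
  -- The constant is `2 · 8 + 384 / 64 = 22`.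
  have h4 : (‖z‖ * L) ^ 4 ≤ 1 / 64 * (‖z‖ * L) ^ 2 := by
    have : (‖z‖ * L) ^ 2 ≤ 1 / 64 := by nlinarith
    calc (‖z‖ * L) ^ 4 = (‖z‖ * L) ^ 2 * (‖z‖ * L) ^ 2 := by ring
      _ ≤ _ := by gcongr
  have h5 : 384 * (‖z‖ * L) ^ 4 * Real.exp (‖w‖ / L) ≤
      384 * (1 / 64 * (‖z‖ * L) ^ 2) * Real.exp (‖w‖ / L) := by gcongr
  rw [sq_norm_primaryFactor]
  rw [abs_le] at h3 ⊢
  have := sq_nonneg ‖primaryFactor (z * w) - 1‖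
  constructor <;> linarith

theorem continuous_primaryFactor : Continuous primaryFactor := by
  unfold primaryFactor
  fun_prop

theorem IsCenteredSubexp.integrable_id (h : IsCenteredSubexp μ L) :
    Integrable (fun w : ℂ => w) μ := by
  refine h.integrable_of_norm_le (C := L) continuous_id.aestronglyMeasurable fun w => ?_
  have h1 := Real.add_one_le_exp (‖w‖ / L)
  have h2 : L * (‖w‖ / L) = ‖w‖ := by have := h.pos; field_simp
  nlinarith [h.pos]

section

variable (h : IsCenteredSubexp μ L) (hz : ‖z‖ * L ≤ 1 / 8)
include h hz

theorem integrable_tiltMass : Integrable (fun w => Real.exp (-2 * (z * w).re)) μ := by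
  refine h.integrable_of_norm_le (C := 1) (by fun_prop) fun w => ?_
  rw [Real.norm_of_nonneg (Real.exp_pos _).le, one_mul]
  exact exp_tilt_le_exp h.pos hz w

theorem integrable_tiltMean :
    Integrable (fun w : ℂ => z * w * Real.exp (-2 * (z * w).re)) μ :=
  h.integrable_of_norm_le (by fun_prop) (norm_mul_exp_tilt_le h.pos hz)

theorem integrable_tiltSq :
    Integrable (fun w => ‖z * w‖ ^ 2 * Real.exp (-2 * (z * w).re)) μ := by
  refine h.integrable_of_norm_le (C := 8 * (‖z‖ * L) ^ 2) (by fun_prop) fun w => ?_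
  rw [Real.norm_of_nonneg (by positivity)]
  exact sq_norm_mul_exp_tilt_le h.pos hz w

/-- From `e^x ≥ 1 + x` and centering. It makes division by the mass harmless. -/
theorem one_le_tiltMass [IsProbabilityMeasure μ] : 1 ≤ tiltMass μ z := by
  have h0 : Integrable (fun w => -2 * (z * w).re) μ :=
    (h.integrable_id.const_mul z).re.const_mul _
  have h1 : Integrable (fun w => 1 + -2 * (z * w).re) μ := (integrable_const _).add h0
  have h2 : ∫ w, (1 + -2 * (z * w).re) ∂μ = 1 := by
    rw [integral_add (integrable_const _) h0,
      integral_const_mul]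
    have : ∫ w, (z * w).re ∂μ = (∫ w, z * w ∂μ).re :=
      integral_re (h.integrable_id.const_mul z)
    rw [this, integral_const_mul, h.mean_zero]
    simp
  rw [← h2]
  refine integral_mono h1 (integrable_tiltMass h hz) fun w => ?_
  have := Real.add_one_le_exp (-2 * (z * w).re)
  dsimp only
  linarith

/-- Centering allows `zw` to be subtracted inside the integral, which gains one order in `‖z‖ L`. -/
theorem norm_tiltMean_le : ‖tiltMean μ z‖ ≤ 32 * (‖z‖ * L) ^ 2 := by
  have h1 : tiltMean μ z = ∫ w, (z * w * Real.exp (-2 * (z * w).re) - z * w) ∂μ := by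
    rw [integral_sub (integrable_tiltMean h hz) (h.integrable_id.const_mul z),
      integral_const_mul, h.mean_zero, mul_zero, sub_zero, tiltMean]
  rw [h1]
  refine (h.norm_integral_le (by positivity) (norm_mul_exp_tilt_sub_le h.pos hz)).trans ?_
  linarith

theorem tiltSq_le : tiltSq μ z ≤ 16 * (‖z‖ * L) ^ 2 := by
  have h1 := h.norm_integral_le (f := fun w => ‖z * w‖ ^ 2 * Real.exp (-2 * (z * w).re))
    (C := 8 * (‖z‖ * L) ^ 2) (by positivity) fun w => by
      rw [Real.norm_of_nonneg (by positivity)]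
      exact sq_norm_mul_exp_tilt_le h.pos hz w
  have h2 := Real.le_norm_self (tiltSq μ z)
  rw [tiltSq] at *
  linarith

theorem vertexMoment_eq :
    vertexMoment μ z = tiltMass μ z + 2 * (tiltMean μ z).re + tiltSq μ z := by
  have i2 : Integrable (fun w : ℂ => (z * w * Real.exp (-2 * (z * w).re)).re) μ :=
    (integrable_tiltMean h hz).re
  have e2 : ∫ w, (z * w * Real.exp (-2 * (z * w).re)).re ∂μ = (tiltMean μ z).re :=
    integral_re (integrable_tiltMean h hz)
  simp only [vertexMoment, sq_norm_primaryFactor_eq]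
  have i3 : Integrable (fun w : ℂ => Real.exp (-2 * (z * w).re) +
      2 * (z * w * Real.exp (-2 * (z * w).re)).re) μ :=
    (integrable_tiltMass h hz).add (i2.const_mul 2)
  rw [integral_add i3 (integrable_tiltSq h hz),
    integral_add (integrable_tiltMass h hz) (i2.const_mul 2), integral_const_mul, e2]
  rfl

theorem integrable_sq_norm_primaryFactor :
    Integrable (fun w => ‖primaryFactor (z * w)‖ ^ 2) μ := by
  simp only [sq_norm_primaryFactor_eq]
  exact ((integrable_tiltMass h hz).add ((integrable_tiltMean h hz).re.const_mul 2)).add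
    (integrable_tiltSq h hz)

theorem abs_vertexMoment_sub_one_le [IsProbabilityMeasure μ] :
    |vertexMoment μ z - 1| ≤ 44 * (‖z‖ * L) ^ 2 := by
  have h1 : vertexMoment μ z - 1 = ∫ w, (‖primaryFactor (z * w)‖ ^ 2 - 1) ∂μ := by
    rw [integral_sub (integrable_sq_norm_primaryFactor h hz) (integrable_const _), vertexMoment]
    simp
  rw [h1]
  refine (h.norm_integral_le (f := fun w => ‖primaryFactor (z * w)‖ ^ 2 - 1)
    (C := 22 * (‖z‖ * L) ^ 2) (by positivity) fun w =>
      (abs_sq_norm_primaryFactor_sub_one_le h.pos hz w)).trans ?_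
  linarith

end

theorem measurable_vertexMoment [SFinite μ] : Measurable (vertexMoment μ) := by
  refine StronglyMeasurable.measurable (StronglyMeasurable.integral_prod_right
    (f := fun z w => ‖primaryFactor (z * w)‖ ^ 2) ?_)
  have : Continuous (fun p : ℂ × ℂ => ‖primaryFactor (p.1 * p.2)‖ ^ 2) :=
    (continuous_primaryFactor.comp (by fun_prop)).norm.pow 2
  exact this.stronglyMeasurable

/-- By the mean value property the real part averages to its value at `z = 0`, which is zero; only
`|g|²` is left. -/
theorem abs_circleAverage_sq_norm_primaryFactor_sub_one_le {R : ℝ} (hR : 0 ≤ R) (hL : 0 < L)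
    (hRL : R * L ≤ 1 / 8) (w : ℂ) :
    |Real.circleAverage (fun z => ‖primaryFactor (z * w)‖ ^ 2) 0 R - 1| ≤
      384 * (R * L) ^ 4 * Real.exp (‖w‖ / L) := by
  have hd : Differentiable ℂ (fun z : ℂ => 1 + 2 * (primaryFactor (z * w) - 1)) := by
    unfold primaryFactor
    fun_prop
  have e1 : Real.circleAverage (fun z : ℂ => 1 + 2 * (primaryFactor (z * w) - 1).re) 0 R = 1 := by
    have h1 := Complex.reCLM.circleAverage_comp_comm
      (hd.continuous.continuousOn.circleIntegrable' (c := 0) (R := R))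
    have h2 := (hd.diffContOnCl (s := Metric.ball (0 : ℂ) |R|)).circleAverage
    rw [h2] at h1
    have h3 : (Complex.reCLM ∘ fun z : ℂ => 1 + 2 * (primaryFactor (z * w) - 1)) =
        fun z : ℂ => 1 + 2 * (primaryFactor (z * w) - 1).re := by
      ext z
      simp
    rw [h3] at h1
    rw [h1]
    simp [primaryFactor]
  have c1 : Continuous (fun z : ℂ => 1 + 2 * (primaryFactor (z * w) - 1).re) := by
    have := continuous_primaryFactor
    fun_prop
  have c2 : Continuous (fun z : ℂ => ‖primaryFactor (z * w) - 1‖ ^ 2) := by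
    have := continuous_primaryFactor
    fun_prop
  simp only [sq_norm_primaryFactor]
  rw [Real.circleAverage_fun_add c1.continuousOn.circleIntegrable'
    c2.continuousOn.circleIntegrable', e1, add_sub_cancel_left,
    abs_of_nonneg (Real.circleAverage_nonneg_of_nonneg fun z _ => by positivity)]
  refine Real.circleAverage_mono_on_of_le_circle c2.continuousOn.circleIntegrable' fun z hz => ?_
  have hz' := norm_mem_of_mem_sphere hR hz
  rw [← hz']
  exact sq_norm_primaryFactor_mul_sub_one_le hL (by rw [hz']; exact hRL) w

theorem abs_circleAverage_vertexMoment_sub_one_le [IsProbabilityMeasure μ]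
    (h : IsCenteredSubexp μ L) {R : ℝ} (hR : 0 ≤ R) (hRL : R * L ≤ 1 / 8) :
    |Real.circleAverage (vertexMoment μ) 0 R - 1| ≤ 768 * (R * L) ^ 4 := by
  have hcont : Continuous (fun p : ℂ × ℂ => ‖primaryFactor (p.1 * p.2)‖ ^ 2) :=
    (continuous_primaryFactor.comp (by fun_prop)).norm.pow 2
  have e1 := circleAverage_integral_swap (P := μ) hR (f := fun z w => ‖primaryFactor (z * w)‖ ^ 2)
    hcont.measurable
    (((integrable_const (1 : ℝ)).add (h.integrable_exp.const_mul (22 * (R * L) ^ 2))))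
    (fun z hz w => by
      have h1 := abs_sq_norm_primaryFactor_sub_one_le h.pos (by rw [hz]; exact hRL) w
      rw [hz] at h1
      have h2 := abs_add_le (‖primaryFactor (z * w)‖ ^ 2 - 1) 1
      rw [sub_add_cancel, abs_one] at h2
      simp only [Pi.add_apply]
      linarith)
  have e2 : Real.circleAverage (vertexMoment μ) 0 R =
      ∫ w, Real.circleAverage (fun z => ‖primaryFactor (z * w)‖ ^ 2) 0 R ∂μ := e1
  have hpt := abs_circleAverage_sq_norm_primaryFactor_sub_one_le hR h.pos hRL
  have hmeas : AEStronglyMeasurable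
      (fun w => Real.circleAverage (fun z => ‖primaryFactor (z * w)‖ ^ 2) 0 R - 1) μ := by
    have hc : Continuous (fun p : ℂ × ℝ => ‖primaryFactor (circleMap 0 R p.2 * p.1)‖ ^ 2) :=
      (continuous_primaryFactor.comp (by fun_prop)).norm.pow 2
    have : Continuous (fun w => ∫ θ in (0 : ℝ)..2 * Real.pi,
        ‖primaryFactor (circleMap 0 R θ * w)‖ ^ 2) :=
      intervalIntegral.continuous_parametric_intervalIntegral_of_continuous' hc _ _
    simp only [Real.circleAverage_def, smul_eq_mul]
    exact ((continuous_const.mul this).sub continuous_const).aestronglyMeasurable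
  have hint : Integrable
      (fun w => Real.circleAverage (fun z => ‖primaryFactor (z * w)‖ ^ 2) 0 R - 1) μ :=
    h.integrable_of_norm_le hmeas hpt
  have e3 : Real.circleAverage (vertexMoment μ) 0 R - 1 =
      ∫ w, (Real.circleAverage (fun z => ‖primaryFactor (z * w)‖ ^ 2) 0 R - 1) ∂μ := by
    rw [e2, integral_sub _ (integrable_const _)]
    · simp
    · exact (hint.add (integrable_const (1 : ℝ))).congr (Eventually.of_forall fun w => by simp)
  rw [e3]
  refine (h.norm_integral_le
    (f := fun w => Real.circleAverage (fun z => ‖primaryFactor (z * w)‖ ^ 2) 0 R - 1)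
    (C := 384 * (R * L) ^ 4) (by positivity) fun w => hpt w).trans ?_
  linarith

/-- The circle average of the logarithm of the single-vertex second moment is of fourth order. -/
theorem log_vertexMoment_bounds [IsProbabilityMeasure μ]
    (h : IsCenteredSubexp μ L) {R : ℝ} (hR : 0 ≤ R) (hRL : (R * L) ^ 2 ≤ 1 / 88) :
    CircleIntegrable (fun z => Real.log (vertexMoment μ z)) 0 R ∧
      (∀ z : ℂ, ‖z‖ = R → |Real.log (vertexMoment μ z)| ≤ 1) ∧
      |Real.circleAverage (fun z => Real.log (vertexMoment μ z)) 0 R| ≤ 4640 * (R * L) ^ 4 := by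
  have hRL0 : 0 ≤ R * L := mul_nonneg hR h.pos.le
  have hRL1 : R * L ≤ 1 / 8 := by nlinarith
  -- The bound `1/88` gives `η ≤ 1/2`; the final constant is `768 + 2 · 44² = 4640`.
  obtain ⟨h1, h2, h3⟩ := circleAverage_log_le_of_abs_sub_one_le (η := 44 * (R * L) ^ 2) hR
    (measurable_vertexMoment (μ := μ)) (by linarith) fun z hz => by
      rw [← hz]
      exact abs_vertexMoment_sub_one_le h (by rw [hz]; exact hRL1)
  refine ⟨h1, fun z hz => (h2 z hz).trans (by linarith), h3.trans ?_⟩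
  have := abs_circleAverage_vertexMoment_sub_one_le h hR hRL1
  calc _ ≤ 768 * (R * L) ^ 4 + 2 * (44 * (R * L) ^ 2) ^ 2 := by gcongr
    _ = _ := by ring

end SingleVertex

/-! ### The second moment as a two-layer partition function. -/

section SecondMoment

variable {V : Type u}

open Classical in
/-- The factor of a single vertex in the expansion of `|X_w (z)|²` over pairs of independent
sets. -/
noncomputable def pairFactor (I J : Finset V) (x : V) (u : ℂ) : ℂ :=
  (if x ∈ I then u else 1) * (if x ∈ J then (starRingEnd ℂ) u else 1) *
    (Real.exp (-2 * u.re) : ℂ)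

variable {μ : Measure ℂ} [IsProbabilityMeasure μ] {L : ℝ} {z : ℂ}

/-- Membership of `x` in `I` and `J` selects one of the four tilted integrals; factoring out the
mass gives an unoccupied vertex weight `1`. -/
theorem integrable_pairFactor (h : IsCenteredSubexp μ L) (hz : ‖z‖ * L ≤ 1 / 8) (I J : Finset V)
    (x : V) : Integrable (fun w => pairFactor I J x (z * w)) μ ∧
      ∫ w, pairFactor I J x (z * w) ∂μ = tiltMass μ z *
        vertexWeight (tiltMean μ z / tiltMass μ z) ((starRingEnd ℂ) (tiltMean μ z) / tiltMass μ z)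
          (tiltSq μ z / tiltMass μ z) x I J := by
  have hm : (tiltMass μ z : ℂ) ≠ 0 := by
    have := one_le_tiltMass h hz
    exact_mod_cast (by linarith : tiltMass μ z ≠ 0)
  have i1 := integrable_tiltMean h hz
  have i2 : Integrable (fun w => ((‖z * w‖ ^ 2 * Real.exp (-2 * (z * w).re) : ℝ) : ℂ)) μ :=
    (integrable_tiltSq h hz).ofReal
  have i3 : Integrable (fun w => ((Real.exp (-2 * (z * w).re) : ℝ) : ℂ)) μ :=
    (integrable_tiltMass h hz).ofReal
  by_cases hI : x ∈ I <;> by_cases hJ : x ∈ J <;>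
    simp only [pairFactor, vertexWeight, hI, hJ, if_true, if_false, one_mul, mul_one]
  · have e : ∀ w, z * w * (starRingEnd ℂ) (z * w) * (Real.exp (-2 * (z * w).re) : ℂ) =
        ((‖z * w‖ ^ 2 * Real.exp (-2 * (z * w).re) : ℝ) : ℂ) := by
      intro w
      rw [Complex.mul_conj']
      push_cast
      rfl
    simp only [e]
    refine ⟨i2, ?_⟩
    rw [integral_complex_ofReal, mul_div_cancel₀ _ hm]
    rfl
  · refine ⟨i1, ?_⟩
    rw [mul_div_cancel₀ _ hm]
    rfl
  · have e : ∀ w, (starRingEnd ℂ) (z * w) * (Real.exp (-2 * (z * w).re) : ℂ) =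
        (starRingEnd ℂ) (z * w * (Real.exp (-2 * (z * w).re) : ℂ)) := by
      intro w
      rw [map_mul _ (z * w), Complex.conj_ofReal]
    simp only [e]
    refine ⟨(Complex.conjCLE.toContinuousLinearMap).integrable_comp i1, ?_⟩
    rw [mul_div_cancel₀ _ hm, integral_conj]
    rfl
  · refine ⟨i3, ?_⟩
    rw [integral_complex_ofReal]
    rfl

variable [Fintype V] (G : SimpleGraph V)

/-- The summation index in `partitionFn` elaborates to a `Set V` coming from a finset, so the sums
are matched along the injective coercion. -/
theorem partitionFn_eq_sum_indepSubsets (w : V → ℂ) :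
    partitionFn G w = ∑ I ∈ indepSubsets G Finset.univ, ∏ x ∈ I, w x := by
  simp only [partitionFn, indepSubsets, Finset.powerset_univ, Finset.bind_def, Finset.pure_def,
    Finset.sup_singleton_apply]
  symm
  refine Finset.sum_bij (fun I _ => (I : Set V)) (fun I hI => ?_)
    (fun I _ J _ h => Finset.coe_injective h) (fun S hS => ?_) (fun I _ => ?_)
  · simpa using hI
  · simp only [Finset.mem_filter, Finset.mem_image, Finset.mem_univ, true_and] at hS
    obtain ⟨⟨I, rfl⟩, hI⟩ := hS
    exact ⟨I, by simpa using hI, rfl⟩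
  · simp

theorem sq_norm_exp_neg_mul_sum (w : V → ℂ) (z : ℂ) :
    ‖Complex.exp (-(z * ∑ x, w x))‖ ^ 2 = ∏ x, Real.exp (-2 * (z * w x).re) := by
  rw [Complex.norm_exp, ← Real.exp_nat_mul, ← Real.exp_sum]
  congr 1
  rw [Finset.mul_sum, Complex.neg_re, Complex.re_sum, ← Finset.mul_sum]
  push_cast
  ring

theorem ofReal_sq_norm_reweighted (w : V → ℂ) (z : ℂ) :
    ((‖reweighted G w z‖ ^ 2 : ℝ) : ℂ) = ∑ I ∈ indepSubsets G Finset.univ,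
      ∑ J ∈ indepSubsets G Finset.univ, ∏ x, pairFactor I J x (z * w x) := by
  classical
  have h1 : ∀ (I : Finset V) (f : V → ℂ), ∏ x ∈ I, f x = ∏ x, if x ∈ I then f x else 1 := by
    intro I f
    rw [Finset.prod_ite_mem, Finset.univ_inter]
  rw [reweighted, norm_mul, mul_pow, sq_norm_exp_neg_mul_sum, Complex.ofReal_mul,
    Complex.ofReal_pow, ← Complex.mul_conj', partitionPoly, partitionFn_eq_sum_indepSubsets,
    map_sum, Finset.sum_mul_sum, Finset.sum_mul]
  refine Finset.sum_congr rfl fun I _ => ?_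
  rw [Finset.sum_mul]
  refine Finset.sum_congr rfl fun J _ => ?_
  rw [map_prod, h1 I, h1 J, Complex.ofReal_prod, ← Finset.prod_mul_distrib,
    ← Finset.prod_mul_distrib]
  rfl

/-- The second moment is a two-layer hardcore partition function. -/
theorem ofReal_secondMoment_eq (h : IsCenteredSubexp μ L) (hz : ‖z‖ * L ≤ 1 / 8) :
    ((secondMoment G (Measure.pi fun _ : V => μ) (fun x w => w x) z : ℝ) : ℂ) =
      (tiltMass μ z : ℂ) ^ Fintype.card V *
        twoLayer G (tiltMean μ z / tiltMass μ z)
          ((starRingEnd ℂ) (tiltMean μ z) / tiltMass μ z) (tiltSq μ z / tiltMass μ z)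
          Finset.univ Finset.univ := by
  have hi : ∀ I J : Finset V, Integrable (fun w : V → ℂ => ∏ x, pairFactor I J x (z * w x))
      (Measure.pi fun _ => μ) := fun I J =>
    Integrable.fintype_prod (f := fun x u => pairFactor I J x (z * u))
      fun x => (integrable_pairFactor h hz I J x).1
  rw [secondMoment, ← integral_complex_ofReal]
  simp only [ofReal_sq_norm_reweighted]
  rw [integral_finsetSum _ fun I _ => integrable_finsetSum _ fun J _ => hi I J, twoLayer,
    Finset.mul_sum]
  refine Finset.sum_congr rfl fun I _ => ?_
  rw [integral_finsetSum _ fun J _ => hi I J, Finset.mul_sum]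
  refine Finset.sum_congr rfl fun J _ => ?_
  rw [integral_fintype_prod_eq_prod (fun x u => pairFactor I J x (z * u)) (μ := fun _ => μ)]
  simp only [(integrable_pairFactor h hz I J _).2]
  rw [Finset.prod_mul_distrib, Finset.prod_const, Finset.card_univ]

theorem continuous_reweighted :
    Continuous (fun p : ℂ × (V → ℂ) => reweighted G p.2 p.1) := by
  unfold reweighted partitionPoly partitionFn
  fun_prop

theorem differentiable_reweighted (w : V → ℂ) : Differentiable ℂ (reweighted G w) := by
  have : reweighted G w = fun z => (∑ I ∈ indepSubsets G Finset.univ, ∏ x ∈ I, (z * w x)) *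
      Complex.exp (-(z * ∑ x, w x)) := by
    ext z
    rw [reweighted, partitionPoly, partitionFn_eq_sum_indepSubsets]
  rw [this]
  fun_prop

theorem norm_partitionFn_le (w : V → ℂ) : ‖partitionFn G w‖ ≤ ∏ x, (1 + ‖w x‖) := by
  classical
  rw [Finset.prod_one_add, partitionFn_eq_sum_indepSubsets]
  refine (norm_sum_le _ _).trans ?_
  simp only [norm_prod]
  exact Finset.sum_le_sum_of_subset_of_nonneg (Finset.filter_subset _ _)
    fun I _ _ => Finset.prod_nonneg fun x _ => norm_nonneg _

/-- An integrable majorant independent of `z` on the whole disc, as needed to exchange expectation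
and circle average. -/
theorem sq_norm_reweighted_le (hL : 0 < L) (hz : ‖z‖ * L ≤ 1 / 8) (w : V → ℂ) :
    ‖reweighted G w z‖ ^ 2 ≤ ∏ x, Real.exp (‖w x‖ / L) := by
  rw [reweighted, norm_mul, mul_pow, sq_norm_exp_neg_mul_sum]
  have h1 : ‖partitionPoly G w z‖ ^ 2 ≤ ∏ x, (1 + ‖z * w x‖) ^ 2 := by
    rw [Finset.prod_pow]
    exact pow_le_pow_left₀ (norm_nonneg _) (norm_partitionFn_le G _) 2
  have h2 : ∀ x, 0 ≤ Real.exp (-2 * (z * w x).re) := fun x => (Real.exp_pos _).le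
  calc _ ≤ (∏ x, (1 + ‖z * w x‖) ^ 2) * ∏ x, Real.exp (-2 * (z * w x).re) :=
        mul_le_mul_of_nonneg_right h1 (Finset.prod_nonneg fun x _ => h2 x)
    _ = ∏ x, ((1 + ‖z * w x‖) ^ 2 * Real.exp (-2 * (z * w x).re)) :=
        Finset.prod_mul_distrib.symm
    _ ≤ _ := by
        refine Finset.prod_le_prod (fun x _ => mul_nonneg (by positivity) (h2 x)) fun x _ => ?_
        have h3 : (1 + ‖z * w x‖) ^ 2 ≤ Real.exp ‖z * w x‖ ^ 2 := by
          refine pow_le_pow_left₀ (by positivity) ?_ 2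
          linarith [Real.add_one_le_exp ‖z * w x‖]
        refine (mul_le_mul h3 (exp_tilt_le hL (w x)) (h2 x) (by positivity)).trans ?_
        rw [← Real.exp_nat_mul, ← Real.exp_add, norm_mul_eq_div hL]
        refine Real.exp_le_exp.2 ?_
        have : 0 ≤ ‖w x‖ / L := by have := norm_nonneg (w x); positivity
        push_cast
        nlinarith

theorem integrable_prod_exp (h : IsCenteredSubexp μ L) :
    Integrable (fun w : V → ℂ => ∏ x, Real.exp (‖w x‖ / L)) (Measure.pi fun _ => μ) :=
  Integrable.fintype_prod (f := fun _ u => Real.exp (‖u‖ / L)) fun _ => h.integrable_exp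

theorem integrable_sq_norm_reweighted (h : IsCenteredSubexp μ L) (hz : ‖z‖ * L ≤ 1 / 8) :
    Integrable (fun w : V → ℂ => ‖reweighted G w z‖ ^ 2) (Measure.pi fun _ => μ) := by
  refine (integrable_prod_exp h).mono' ?_ (Eventually.of_forall fun w => ?_)
  · exact (((continuous_reweighted G).comp (Continuous.prodMk_right z)).norm.pow
      2).aestronglyMeasurable
  · rw [Real.norm_of_nonneg (by positivity)]
    exact sq_norm_reweighted_le G h.pos hz w

theorem measurable_secondMoment :
    Measurable (secondMoment G (Measure.pi fun _ : V => μ) (fun x w => w x)) := by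
  refine StronglyMeasurable.measurable (StronglyMeasurable.integral_prod_right
    (f := fun z w => ‖reweighted G w z‖ ^ 2) ?_)
  exact ((continuous_reweighted G).norm.pow 2).stronglyMeasurable

open Classical in
/-- The logarithm of the second moment is `|V|` times that of the single-vertex second moment, up
to the contribution of the edges. -/
theorem secondMoment_pos_and_abs_log_sub_le {D : ℕ}
    (hD : ∀ x, (Finset.univ.filter (G.Adj x)).card ≤ D) (h : IsCenteredSubexp μ L)
    (hz : (2 * D + 1) * (‖z‖ * L) ^ 2 ≤ 1 / 384) :
    0 < secondMoment G (Measure.pi fun _ : V => μ) (fun x w => w x) z ∧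
      |Real.log (secondMoment G (Measure.pi fun _ : V => μ) (fun x w => w x) z) -
        Fintype.card V * Real.log (vertexMoment μ z)| ≤
      Fintype.card V * (294912 * D * (‖z‖ * L) ^ 4) := by
  have hL := h.pos
  have hD0 : (0 : ℝ) ≤ D := by positivity
  have hρ0 : 0 ≤ ‖z‖ * L := by positivity
  have hρ : (‖z‖ * L) ^ 2 ≤ 1 / 384 := by nlinarith [sq_nonneg (‖z‖ * L)]
  have hz' : ‖z‖ * L ≤ 1 / 8 := by nlinarith
  have hm := one_le_tiltMass h hz'
  have hm0 : 0 < tiltMass μ z := by linarith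
  have hs0 : 0 ≤ tiltSq μ z := integral_nonneg fun w => by positivity
  set a : ℂ := tiltMean μ z / tiltMass μ z with ha
  set a' : ℂ := (starRingEnd ℂ) (tiltMean μ z) / tiltMass μ z with ha'
  set b : ℂ := tiltSq μ z / tiltMass μ z with hb
  have na : ‖a‖ ≤ 32 * (‖z‖ * L) ^ 2 := by
    rw [ha, norm_div, Complex.norm_real, Real.norm_of_nonneg hm0.le]
    exact (div_le_self (norm_nonneg _) hm).trans (norm_tiltMean_le h hz')
  have na' : ‖a'‖ ≤ 32 * (‖z‖ * L) ^ 2 := by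
    rw [ha', norm_div, Complex.norm_real, Real.norm_of_nonneg hm0.le, RCLike.norm_conj]
    exact (div_le_self (norm_nonneg _) hm).trans (norm_tiltMean_le h hz')
  have nb : ‖b‖ ≤ 16 * (‖z‖ * L) ^ 2 := by
    rw [hb, norm_div, Complex.norm_real, Complex.norm_real, Real.norm_of_nonneg hm0.le,
      Real.norm_of_nonneg hs0]
    exact (div_le_self hs0 hm).trans (tiltSq_le h hz')
  -- `48 = 32 + 16`; the smallness condition is `(2D+1) · 192ρ² ≤ 1/2`, that is `1/384`, and `128 ·
  -- 48² = 294912`.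
  obtain ⟨hZ0, hZ⟩ := twoLayer_univ_ne_zero_and_abs_log_sub_le G hD (ε := 48 * (‖z‖ * L) ^ 2)
    (a := a) (a' := a') (b := b) (by linarith) (by linarith) (by linarith)
  have hF := ofReal_secondMoment_eq G h hz'
  set F := secondMoment G (Measure.pi fun _ : V => μ) (fun x w => w x) z with hFdef
  have hF0 : 0 ≤ F := integral_nonneg fun w => by positivity
  have hFn : F = tiltMass μ z ^ Fintype.card V *
      ‖twoLayer G a a' b Finset.univ Finset.univ‖ := by
    have := congrArg norm hF
    rwa [Complex.norm_real, Real.norm_of_nonneg hF0, norm_mul, norm_pow, Complex.norm_real,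
      Real.norm_of_nonneg hm0.le] at this
  have hZn := norm_pos_iff.2 hZ0
  refine ⟨by rw [hFn]; positivity, ?_⟩
  -- Hence the powers of the mass cancel in the difference of logarithms.
  have hv : ((vertexMoment μ z : ℝ) : ℂ) = tiltMass μ z * (1 + a + a' + b) := by
    have h0 : (tiltMass μ z : ℂ) ≠ 0 := by exact_mod_cast hm0.ne'
    have h1 : (tiltMass μ z : ℂ) * (1 + a + a' + b) =
        tiltMass μ z + (tiltMean μ z + (starRingEnd ℂ) (tiltMean μ z)) + tiltSq μ z := by
      rw [ha, ha', hb]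
      field_simp
      ring
    rw [h1, Complex.add_conj, vertexMoment_eq h hz']
    push_cast
    ring
  have hv0 : 0 < vertexMoment μ z := by
    have := abs_le.1 (abs_vertexMoment_sub_one_le h hz')
    linarith
  have hvn : vertexMoment μ z = tiltMass μ z * ‖1 + a + a' + b‖ := by
    have := congrArg norm hv
    rwa [Complex.norm_real, Real.norm_of_nonneg hv0.le, norm_mul, Complex.norm_real,
      Real.norm_of_nonneg hm0.le] at this
  have hn0 : ‖1 + a + a' + b‖ ≠ 0 := by
    intro h0
    rw [h0, mul_zero] at hvn
    linarith
  have e : Real.log F - Fintype.card V * Real.log (vertexMoment μ z) =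
      Real.log ‖twoLayer G a a' b Finset.univ Finset.univ‖ -
        Fintype.card V * Real.log ‖1 + a + a' + b‖ := by
    rw [hFn, hvn, Real.log_mul (by positivity) hZn.ne', Real.log_pow,
      Real.log_mul hm0.ne' hn0]
    ring
  rw [e]
  refine hZ.trans (le_of_eq ?_)
  ring

open Classical in
/-- The circle average of the logarithm of the second moment is of fourth order. -/
theorem log_secondMoment_bounds {D : ℕ} (hD : ∀ x, (Finset.univ.filter (G.Adj x)).card ≤ D)
    (h : IsCenteredSubexp μ L) {R : ℝ} (hR : 0 ≤ R)
    (hRL : (2 * D + 1) * (R * L) ^ 2 ≤ 1 / 384) :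
    LogSecondMomentWellDefined G (Measure.pi fun _ : V => μ) (fun x w => w x) R ∧
      (∃ B, ∀ z : ℂ, ‖z‖ = R →
        |Real.log (secondMoment G (Measure.pi fun _ : V => μ) (fun x w => w x) z)| ≤ B) ∧
      |avgLogSecondMoment G (Measure.pi fun _ : V => μ) (fun x w => w x) R| ≤
        300000 * (Fintype.card V * (1 + D) * (R * L) ^ 4) := by
  set F := secondMoment G (Measure.pi fun _ : V => μ) (fun x w => w x) with hF
  have hD0 : (0 : ℝ) ≤ D := by positivity
  have hρ : (R * L) ^ 2 ≤ 1 / 384 := by nlinarith [sq_nonneg (R * L)]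
  have hρ0 : 0 ≤ R * L := mul_nonneg hR h.pos.le
  have hρ1 : R * L ≤ 1 / 8 := by nlinarith
  obtain ⟨c1, c2, c3⟩ := log_vertexMoment_bounds h hR (by linarith)
  have key : ∀ z : ℂ, ‖z‖ = R → 0 < F z ∧
      |Real.log (F z) - Fintype.card V * Real.log (vertexMoment μ z)| ≤
        Fintype.card V * (294912 * D * (R * L) ^ 4) := by
    rintro z rfl
    exact secondMoment_pos_and_abs_log_sub_le G hD h hRL
  set E : ℝ := Fintype.card V * (294912 * D * (R * L) ^ 4) with hE
  have hB : ∀ z : ℂ, ‖z‖ = R → |Real.log (F z)| ≤ E + Fintype.card V * 1 := by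
    intro z hz
    have h1 := (key z hz).2
    have h2 := abs_add_le (Real.log (F z) - Fintype.card V * Real.log (vertexMoment μ z))
      (Fintype.card V * Real.log (vertexMoment μ z))
    rw [sub_add_cancel] at h2
    refine h2.trans (add_le_add h1 ?_)
    rw [abs_mul, Nat.abs_cast]
    exact mul_le_mul_of_nonneg_left (c2 z hz) (by positivity)
  have i1 : CircleIntegrable (fun z => Real.log (F z)) 0 R :=
    circleIntegrable_of_abs_le hR (measurable_secondMoment G).log hB
  refine ⟨⟨fun z hz => ⟨integrable_sq_norm_reweighted G h (by rw [hz]; exact hρ1),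
    (key z hz).1⟩, i1⟩, ⟨_, hB⟩, ?_⟩
  have i2 : CircleIntegrable (fun z => Fintype.card V * Real.log (vertexMoment μ z)) 0 R :=
    IntervalIntegrable.const_mul c1 _
  have i3 : CircleIntegrable
      (fun z => Real.log (F z) - Fintype.card V * Real.log (vertexMoment μ z)) 0 R := i1.sub i2
  have e1 : |Real.circleAverage
      (fun z => Real.log (F z) - Fintype.card V * Real.log (vertexMoment μ z)) 0 R| ≤ E := by
    refine Real.abs_circleAverage_le_circleAverage_abs.trans ?_
    exact Real.circleAverage_mono_on_of_le_circle i3.abs fun z hz =>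
      (key z (norm_mem_of_mem_sphere hR hz)).2
  have e2 : Real.circleAverage (fun z => Fintype.card V * Real.log (vertexMoment μ z)) 0 R =
      Fintype.card V * Real.circleAverage (fun z => Real.log (vertexMoment μ z)) 0 R :=
    Real.circleAverage_fun_smul (a := (Fintype.card V : ℝ))
      (f := fun z => Real.log (vertexMoment μ z))
  rw [Real.circleAverage_fun_sub i1 i2, e2] at e1
  have e3 := abs_add_le (Real.circleAverage (fun z => Real.log (F z)) 0 R -
    Fintype.card V * Real.circleAverage (fun z => Real.log (vertexMoment μ z)) 0 R)
    (Fintype.card V * Real.circleAverage (fun z => Real.log (vertexMoment μ z)) 0 R)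
  rw [sub_add_cancel, abs_mul, Nat.abs_cast] at e3
  have e4 : (Fintype.card V : ℝ) *
      |Real.circleAverage (fun z => Real.log (vertexMoment μ z)) 0 R| ≤
      Fintype.card V * (4640 * (R * L) ^ 4) := mul_le_mul_of_nonneg_left c3 (by positivity)
  -- `294912` from the edges and `4640` from the vertices are both below `300000`.
  have e5 : E + Fintype.card V * (4640 * (R * L) ^ 4) ≤
      300000 * (Fintype.card V * (1 + D) * (R * L) ^ 4) := by
    have h1 : 0 ≤ (Fintype.card V : ℝ) * (R * L) ^ 4 := by positivity
    have h2 : 0 ≤ (Fintype.card V : ℝ) * (R * L) ^ 4 * D := by positivity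
    rw [hE]
    nlinarith
  rw [avgLogSecondMoment]
  linarith

end SecondMoment

/-! ### Jensen's formula and random entire functions. -/

section Jensen

/-- Jensen's formula; the central term is `log 1 = 0`, and all other terms are nonnegative since the
zeros counted have modulus at most `R`. -/
theorem circleAverage_log_norm_eq_finsum {f : ℂ → ℂ} (hf : Differentiable ℂ f) (hf0 : f 0 = 1)
    {R : ℝ} (hR : 0 < R) :
    ∃ d : ℂ → ℝ, d.support.Finite ∧ (∀ z, 0 ≤ d z * Real.log (R * ‖z‖⁻¹)) ∧
      (∀ z, ‖z‖ ≤ R → analyticOrderAt f z ≠ ⊤ ∧ d z = analyticOrderNatAt f z) ∧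
      Real.circleAverage (fun z => Real.log ‖f z‖) 0 R = ∑ᶠ z, d z * Real.log (R * ‖z‖⁻¹) := by
  have han : AnalyticOnNhd ℂ f (Metric.closedBall 0 |R|) := fun z _ =>
    (hf.differentiableOn (s := Set.univ)).analyticAt univ_mem
  have hana : AnalyticOnNhd ℂ f Set.univ := fun z _ =>
    (hf.differentiableOn (s := Set.univ)).analyticAt univ_mem
  have hJ := han.circleAverage_log_norm hR.ne' (by rw [hf0]; exact one_ne_zero)
  rw [hf0, norm_one, Real.log_one, add_zero] at hJ
  simp only [zero_sub, norm_neg] at hJ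
  set d := MeromorphicOn.divisor f (Metric.closedBall 0 |R|) with hd
  have hfin := d.finiteSupport (isCompact_closedBall 0 |R|)
  have hord : ∀ z, analyticOrderAt f z ≠ ⊤ := fun z =>
    hana.analyticOrderAt_ne_top_of_isPreconnected isPreconnected_univ (Set.mem_univ 0)
      (Set.mem_univ z) (by
        rw [(hana 0 (Set.mem_univ 0)).analyticOrderAt_eq_zero.2 (by rw [hf0]; exact one_ne_zero)]
        simp)
  have hdz : ∀ z ∈ Metric.closedBall (0 : ℂ) |R|, d z = (analyticOrderNatAt f z : ℤ) := by
    intro z hz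
    rw [hd, MeromorphicOn.AnalyticOnNhd.divisor_apply han hz,
      ← Nat.cast_analyticOrderNatAt (hord z)]
    rfl
  refine ⟨fun z => d z, hfin.subset fun z hz h0 => hz ?_, fun z => ?_, fun z hz => ⟨hord z, ?_⟩,
    hJ⟩
  · simp only [h0, Int.cast_zero]
  · by_cases hz : z ∈ Metric.closedBall (0 : ℂ) |R|
    · simp only [hdz z hz]
      refine mul_nonneg (by positivity) ?_
      -- At the origin the default values `0⁻¹ = 0` and `log 0 = 0` make the term vanish.
      rcases eq_or_ne z 0 with rfl | h0
      · simp
      · refine Real.log_nonneg ?_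
        rw [← div_eq_mul_inv, one_le_div (norm_pos_iff.2 h0)]
        simpa [abs_of_pos hR] using hz
    · simp [Function.locallyFinsuppWithin.apply_eq_zero_of_notMem _ hz]
  · simp [hdz z (by simpa [abs_of_pos hR] using hz)]

theorem circleAverage_log_norm_nonneg {f : ℂ → ℂ} (hf : Differentiable ℂ f) (hf0 : f 0 = 1)
    {R : ℝ} (hR : 0 < R) : 0 ≤ Real.circleAverage (fun z => Real.log ‖f z‖) 0 R := by
  obtain ⟨d, -, hterm, -, hJ⟩ := circleAverage_log_norm_eq_finsum hf hf0 hR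
  rw [hJ]
  exact finsum_nonneg hterm

/-- **Jensen's inequality** for the number of zeros of an entire function. -/
theorem zeroCount_le_of_differentiable {f : ℂ → ℂ} (hf : Differentiable ℂ f) (hf0 : f 0 = 1)
    {r R : ℝ} (hr : 0 < r) (hrR : r < R) :
    zeroCount f r ≤ ENNReal.ofReal
      (Real.circleAverage (fun z => Real.log ‖f z‖) 0 R / Real.log (R / r)) := by
  classical
  have hlog : 0 < Real.log (R / r) := Real.log_pos ((one_lt_div hr).2 hrR)
  obtain ⟨d, hfin, hterm, hd, hJ⟩ := circleAverage_log_norm_eq_finsum hf hf0 (hr.trans hrR)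
  have hlt : ∀ z : Metric.ball (0 : ℂ) r, ‖(z : ℂ)‖ < r := fun z => mem_ball_zero_iff.1 z.2
  rw [zeroCount, ENNReal.tsum_eq_iSup_sum]
  refine iSup_le fun s => ?_
  have e1 : ∀ z : Metric.ball (0 : ℂ) r, ((analyticOrderAt f (z : ℂ) : ℕ∞) : ℝ≥0∞) =
      ENNReal.ofReal (analyticOrderNatAt f z) := by
    intro z
    rw [← Nat.cast_analyticOrderNatAt (hd z ((hlt z).trans hrR).le).1, ENat.toENNReal_coe,
      ENNReal.ofReal_natCast]
  simp only [e1]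
  rw [← ENNReal.ofReal_sum_of_nonneg fun _ _ => by positivity]
  refine ENNReal.ofReal_le_ofReal ?_
  -- Enlarging the support by `s` turns the formula into a finite sum, from which the nonnegative
  -- terms outside `s` can be dropped.
  rw [le_div_iff₀ hlog, hJ, finsum_eq_sum_of_support_subset
    (s := hfin.toFinset ∪ s.map (Function.Embedding.subtype _)) _ (by
      intro z hz
      simp only [Finset.coe_union, Set.Finite.coe_toFinset]
      left
      intro h0
      apply hz
      simp only [h0, zero_mul])]
  refine le_trans ?_ (Finset.sum_le_sum_of_subset_of_nonneg Finset.subset_union_right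
    fun z _ _ => hterm z)
  rw [Finset.sum_map, Finset.sum_mul]
  refine Finset.sum_le_sum fun z _ => ?_
  simp only [Function.Embedding.subtype_apply]
  rw [(hd z ((hlt z).trans hrR).le).2]
  rcases eq_or_ne (z : ℂ) 0 with h0 | h0
  · have : analyticOrderNatAt f (0 : ℂ) = 0 := by
      rw [analyticOrderNatAt, ((hf.differentiableOn (s := Set.univ)).analyticAt
        univ_mem).analyticOrderAt_eq_zero.2 (by rw [hf0]; exact one_ne_zero)]
      rfl
    rw [h0, this]
    simp
  · have hz0 : 0 < ‖(z : ℂ)‖ := norm_pos_iff.2 h0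
    rw [← div_eq_mul_inv]
    have := (hr.trans hrR)
    gcongr
    exact (hlt z).le

/-- A zero of an entire function in the disc is counted. -/
theorem one_le_zeroCount {f : ℂ → ℂ} {r : ℝ} {z : ℂ} (hz : z ∈ Metric.ball (0 : ℂ) r)
    (hf : Differentiable ℂ f) (h0 : f z = 0) : 1 ≤ zeroCount f r := by
  have han : AnalyticAt ℂ f z := (hf.differentiableOn (s := Set.univ)).analyticAt univ_mem
  refine le_trans ?_ (ENNReal.le_tsum (⟨z, hz⟩ : Metric.ball (0 : ℂ) r))
  rw [← ENat.toENNReal_one, ENat.toENNReal_le]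
  rw [Order.one_le_iff_ne_zero]
  exact fun h => (han.analyticOrderAt_eq_zero.1 h) h0

/-- Random entire functions with `f ω 0 = 1`: the circle average of `log |f ω|²` is dominated by a
random variable whose mean is the circle average of the logarithm of the second moment. -/
theorem exists_dominating_circleAverage {Ω : Type*} [MeasurableSpace Ω] {P : Measure Ω}
    [IsProbabilityMeasure P] {f : Ω → ℂ → ℂ} (hf : ∀ ω, Differentiable ℂ (f ω))
    (hf1 : ∀ ω, f ω 0 = 1)
    (hmeas : Measurable (fun p : ℂ × Ω => ‖f p.2 p.1‖ ^ 2)) {R : ℝ} (hR0 : 0 < R)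
    {g : Ω → ℝ} (hg : Integrable g P) (hfg : ∀ z : ℂ, ‖z‖ = R → ∀ ω, ‖f ω z‖ ^ 2 ≤ g ω)
    {F : ℂ → ℝ} (hF : ∀ z, F z = ∫ ω, ‖f ω z‖ ^ 2 ∂P) (hFm : Measurable F)
    (hF0 : ∀ z : ℂ, ‖z‖ = R → 0 < F z) {B : ℝ}
    (hB : ∀ z : ℂ, ‖z‖ = R → |Real.log (F z)| ≤ B) :
    ∃ Y : Ω → ℝ, Measurable Y ∧ Integrable Y P ∧
      (∀ ω, 2 * Real.circleAverage (fun z => Real.log ‖f ω z‖) 0 R ≤ Y ω) ∧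
      ∫ ω, Y ω ∂P = Real.circleAverage (fun z => Real.log (F z)) 0 R := by
  have hR : 0 ≤ R := hR0.le
  have hlogint : CircleIntegrable (fun z => Real.log (F z)) 0 R :=
    circleIntegrable_of_abs_le hR hFm.log hB
  have hinv : ∀ z : ℂ, ‖z‖ = R → (F z)⁻¹ ≤ Real.exp B := by
    intro z hz
    rw [← Real.exp_log (inv_pos.2 (hF0 z hz)), Real.log_inv]
    exact Real.exp_le_exp.2 (by linarith [(abs_le.1 (hB z hz)).1])
  have hq : ∀ z : ℂ, ‖z‖ = R → ∀ ω, |‖f ω z‖ ^ 2 / F z| ≤ g ω * Real.exp B := by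
    intro z hz ω
    have h0 := hF0 z hz
    rw [abs_of_nonneg (by positivity), div_eq_mul_inv]
    exact mul_le_mul (hfg z hz ω) (hinv z hz) (by positivity)
      ((by positivity : (0 : ℝ) ≤ ‖f ω z‖ ^ 2).trans (hfg z hz ω))
  have hqm : Measurable (Function.uncurry fun (z : ℂ) (ω : Ω) => ‖f ω z‖ ^ 2 / F z) :=
    hmeas.div (hFm.comp measurable_fst)
  have hqint : ∀ ω, CircleIntegrable (fun z => ‖f ω z‖ ^ 2 / F z) 0 R := fun ω =>
    circleIntegrable_of_abs_le hR (hqm.comp measurable_prodMk_right) fun z hz => hq z hz ω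
  set A : Ω → ℝ := fun ω => Real.circleAverage (fun z => ‖f ω z‖ ^ 2 / F z) 0 R with hA
  have hAm : Measurable A := by
    have h1 : Measurable (Function.uncurry fun (θ : ℝ) (ω : Ω) =>
        ‖f ω (circleMap 0 R θ)‖ ^ 2 / F (circleMap 0 R θ)) :=
      hqm.comp (((continuous_circleMap 0 R).measurable.comp measurable_fst).prodMk
        measurable_snd)
    have h2 := (h1.stronglyMeasurable.integral_prod_left
      (μ := (volume : Measure ℝ).restrict (Set.Ioc 0 (2 * Real.pi)))).measurable
    simp only [hA, Real.circleAverage_def, smul_eq_mul,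
      intervalIntegral.integral_of_le Real.two_pi_pos.le]
    exact h2.const_mul _
  have hAint : Integrable A P := by
    refine (hg.mul_const (Real.exp B)).mono' hAm.aestronglyMeasurable
      (Eventually.of_forall fun ω => ?_)
    refine Real.abs_circleAverage_le_circleAverage_abs.trans ?_
    exact Real.circleAverage_mono_on_of_le_circle (hqint ω).abs fun z hz =>
      hq z (norm_mem_of_mem_sphere hR hz) ω
  have hAmean : ∫ ω, A ω ∂P = 1 := by
    have h1 := circleAverage_integral_swap (P := P) hR hqm (hg.mul_const (Real.exp B)) hq
    rw [← h1, ← Real.circleAverage_const (1 : ℝ) 0 R]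
    refine Real.circleAverage_congr_sphere fun z hz => ?_
    have h0 := hF0 z (norm_mem_of_mem_sphere hR hz)
    simp only [integral_div, ← hF]
    exact div_self h0.ne'
  -- The tangent bound `log t ≤ log F + t/F - 1`, averaged over the circle, with `E A = 1`. No
  -- integrability in `ω` of the averaged `log ‖f ω‖` is required.
  refine ⟨fun ω => Real.circleAverage (fun z => Real.log (F z)) 0 R + A ω - 1,
    (hAm.const_add _).sub_const _, ((integrable_const _).add hAint).sub (integrable_const _),
    fun ω => ?_, ?_⟩
  · have hmero : CircleIntegrable (fun z => Real.log ‖f ω z‖) 0 R := by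
      refine MeromorphicOn.circleIntegrable_log_norm fun z _ => ?_
      exact (((hf ω).differentiableOn (s := Set.univ)).analyticAt univ_mem).meromorphicAt
    have i1 : CircleIntegrable (fun z => 2 * Real.log ‖f ω z‖) 0 R :=
      IntervalIntegrable.const_mul hmero 2
    have i2 : CircleIntegrable (fun z => Real.log (F z) + ‖f ω z‖ ^ 2 / F z) 0 R :=
      hlogint.add (hqint ω)
    have i3 : CircleIntegrable (fun _ => (1 : ℝ)) (0 : ℂ) R := circleIntegrable_const _ _ _
    have i4 : CircleIntegrable (fun z => Real.log (F z) + ‖f ω z‖ ^ 2 / F z - 1) 0 R := i2.sub i3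
    have e1 : Real.circleAverage (fun z => Real.log (F z) + ‖f ω z‖ ^ 2 / F z - 1) 0 R =
        Real.circleAverage (fun z => Real.log (F z)) 0 R + A ω - 1 := by
      rw [Real.circleAverage_fun_sub i2 i3, Real.circleAverage_fun_add hlogint (hqint ω),
        Real.circleAverage_const]
    have e2 : Real.circleAverage (fun z => 2 * Real.log ‖f ω z‖) 0 R =
        2 * Real.circleAverage (fun z => Real.log ‖f ω z‖) 0 R :=
      Real.circleAverage_fun_smul (a := (2 : ℝ)) (f := fun z => Real.log ‖f ω z‖)
    simp only [← e1, ← e2]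
    -- At a zero of `f ω` the default `log 0 = 0` may exceed the majorant, so the function is first
    -- changed on this discrete set.
    have e3 : (fun z => 2 * Real.log ‖f ω z‖) =ᶠ[codiscreteWithin (Metric.sphere 0 |R|)]
        fun z => if f ω z = 0 then Real.log (F z) + ‖f ω z‖ ^ 2 / F z - 1
          else 2 * Real.log ‖f ω z‖ := by
      have h1 : f ω ⁻¹' {0}ᶜ ∈ codiscrete ℂ :=
        AnalyticOnNhd.preimage_zero_mem_codiscrete (x := 0)
          (fun z _ => ((hf ω).differentiableOn (s := Set.univ)).analyticAt univ_mem)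
          (by rw [hf1]; exact one_ne_zero)
      filter_upwards [codiscreteWithin_mono (Set.subset_univ _) h1] with z hz
      exact (if_neg (show ¬ f ω z = 0 from hz)).symm
    rw [Real.circleAverage_congr_codiscreteWithin e3 hR0.ne']
    refine Real.circleAverage_mono (i1.congr_codiscreteWithin e3) i4 fun z hz => ?_
    have h0 := hF0 z (norm_mem_of_mem_sphere hR hz)
    split_ifs with hz0
    · exact le_rfl
    · have h1 : 0 < ‖f ω z‖ ^ 2 := pow_pos (norm_pos_iff.2 hz0) 2
      have h2 := Real.log_le_sub_one_of_pos (div_pos h1 h0)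
      rw [Real.log_div h1.ne' h0.ne', Real.log_pow] at h2
      push_cast at h2
      linarith
  · have i1 : Integrable
        (fun ω => Real.circleAverage (fun z => Real.log (F z)) 0 R + A ω) P :=
      (integrable_const _).add hAint
    rw [integral_sub i1 (integrable_const _),
      integral_add (integrable_const _) hAint, hAmean]
    simp

end Jensen

/-! ### From the `ψ₁` hypothesis to a common law with an exponential moment. -/

section Law

theorem lintegral_exp_le_two_of_psiOneNorm_lt {Ω : Type v} [MeasurableSpace Ω] {P : Measure Ω}
    {X : Ω → ℝ} {t : ℝ} (h : psiOneNorm P X < ENNReal.ofReal t) :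
    ∫⁻ ω, ENNReal.ofReal (Real.exp (|X ω| / t)) ∂P ≤ 2 := by
  simp only [psiOneNorm, iInf_lt_iff] at h
  obtain ⟨s, hs, hs2, hst⟩ := h
  have hst' : s < t := (ENNReal.ofReal_lt_ofReal_iff_of_nonneg hs.le).1 hst
  refine (lintegral_mono fun ω => ENNReal.ofReal_le_ofReal (Real.exp_le_exp.2 ?_)).trans hs2
  gcongr

/-- From `‖w‖ ≤ |Re w| + |Im w|` and `e^{(p+q)/2} ≤ (e^p + e^q)/2`. -/
theorem exp_norm_div_le (w : ℂ) {t : ℝ} (ht : 0 < t) :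
    Real.exp (‖w‖ / (2 * t)) ≤ 1 / 2 * (Real.exp (|w.re| / t) + Real.exp (|w.im| / t)) := by
  have h1 := Complex.norm_le_abs_re_add_abs_im w
  have h2 : ‖w‖ / (2 * t) ≤ |w.re| / t / 2 + |w.im| / t / 2 := by
    have h4 : |w.re| / t / 2 + |w.im| / t / 2 = (|w.re| + |w.im|) / (2 * t) := by
      field_simp
    rw [h4]
    gcongr
  have h3 : ∀ x : ℝ, Real.exp (x / 2) ^ 2 = Real.exp x := fun x => by
    rw [← Real.exp_nat_mul]
    congr 1
    push_cast
    ring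
  calc _ ≤ Real.exp (|w.re| / t / 2) * Real.exp (|w.im| / t / 2) := by
        rw [← Real.exp_add]
        exact Real.exp_le_exp.2 h2
    _ ≤ _ := by
        rw [← h3 (|w.re| / t), ← h3 (|w.im| / t)]
        nlinarith [sq_nonneg (Real.exp (|w.re| / t / 2) - Real.exp (|w.im| / t / 2))]

variable {V : Type u} {Ω : Type v} [MeasurableSpace Ω] {P : Measure Ω} {W : V → Ω → ℂ} {ν K : ℝ}

theorem IsSubexpIID.aemeasurable (h : IsSubexpIID P W ν K) (x : V) : AEMeasurable (W x) P :=
  (h.memLp_two x).1.aemeasurable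

/-- Covers the degenerate case, since the asymptotic statement puts no sign condition on `ν`. -/
theorem IsSubexpIID.ae_eq_zero [IsProbabilityMeasure P] (h : IsSubexpIID P W ν K) (hν : ν ≤ 0)
    (x : V) : W x =ᵐ[P] 0 := by
  have h1 := h.second_moment x
  have h2 : Integrable (fun ω => ‖W x ω‖ ^ 2) P := (h.memLp_two x).integrable_norm_pow (by simp)
  have h3 : ∫ ω, ‖W x ω‖ ^ 2 ∂P = 0 :=
    le_antisymm (h1.trans_le hν) (integral_nonneg fun ω => by positivity)
  filter_upwards [(integral_eq_zero_iff_of_nonneg (fun ω => by positivity) h2).1 h3] with ω hω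
  simpa using hω

theorem IsSubexpIID.lintegral_exp_le (h : IsSubexpIID P W ν K) (hK : 0 < K) (hν : 0 < ν) (x : V) :
    ∫⁻ ω, ENNReal.ofReal (Real.exp (‖W x ω‖ / (4 * K * √ν))) ∂P ≤ 2 := by
  have hs : 0 < K * √ν := by positivity
  -- Doubling gives a strict inequality with the infimum, which need not be attained; a second
  -- doubling, from `exp_norm_div_le`, produces `4K√ν`.
  set t := 2 * (K * √ν) with ht
  have ht0 : 0 < t := by positivity
  have key : ∀ φ ∈ Set.Ico (0 : ℝ) (2 * Real.pi), ∫⁻ ω, ENNReal.ofReal (Real.exp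
      (|(Complex.exp (-(Complex.I * (φ : ℂ))) * W x ω).re| / t)) ∂P ≤ 2 := by
    intro φ hφ
    refine lintegral_exp_le_two_of_psiOneNorm_lt (lt_of_le_of_lt ?_
      ((ENNReal.ofReal_lt_ofReal_iff_of_nonneg hs.le).2 (by linarith : K * √ν < t)))
    exact (le_iSup₂ (f := fun (φ : ℝ) (_ : φ ∈ Set.Ico (0 : ℝ) (2 * Real.pi)) =>
      psiOneNorm P (fun ω => (Complex.exp (-(Complex.I * (φ : ℂ))) * W x ω).re)) φ hφ).trans
      (h.subexp x)
  -- The angles `0` and `π/2` give the real and imaginary parts.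
  have h1 := key 0 ⟨le_rfl, Real.two_pi_pos⟩
  have h2 := key (Real.pi / 2) ⟨by positivity, by linarith [Real.pi_pos]⟩
  have e1 : Complex.exp (-(Complex.I * ((0 : ℝ) : ℂ))) = 1 := by simp
  have e2 : Complex.exp (-(Complex.I * ((Real.pi / 2 : ℝ) : ℂ))) = -Complex.I := by
    rw [mul_comm, Complex.exp_neg]
    push_cast
    rw [Complex.exp_pi_div_two_mul_I, Complex.inv_I]
  simp only [e1, e2, one_mul, neg_mul, Complex.neg_re, Complex.I_mul_re, neg_neg] at h1 h2
  have hm := h.aemeasurable x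
  calc _ ≤ ∫⁻ ω, (ENNReal.ofReal (1 / 2) * (ENNReal.ofReal (Real.exp (|(W x ω).re| / t)) +
        ENNReal.ofReal (Real.exp (|(W x ω).im| / t)))) ∂P := by
        refine lintegral_mono fun ω => ?_
        rw [← ENNReal.ofReal_add (by positivity) (by positivity),
          ← ENNReal.ofReal_mul (by norm_num)]
        refine ENNReal.ofReal_le_ofReal ?_
        rw [show 4 * K * √ν = 2 * t by rw [ht]; ring]
        exact exp_norm_div_le _ ht0
    _ = ENNReal.ofReal (1 / 2) * (∫⁻ ω, ENNReal.ofReal (Real.exp (|(W x ω).re| / t)) ∂P +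
        ∫⁻ ω, ENNReal.ofReal (Real.exp (|(W x ω).im| / t)) ∂P) := by
        have hre : AEMeasurable (fun ω => ENNReal.ofReal (Real.exp (|(W x ω).re| / t))) P := by
          have := Complex.measurable_re.comp_aemeasurable hm
          exact (Real.measurable_exp.comp_aemeasurable
            ((measurable_abs.comp_aemeasurable this).div_const t)).ennreal_ofReal
        rw [lintegral_const_mul' _ _ ENNReal.ofReal_ne_top, lintegral_add_left' hre]
    _ ≤ ENNReal.ofReal (1 / 2) * (2 + 2) := by gcongr
    _ = 2 := by
        rw [show (2 + 2 : ℝ≥0∞) = ENNReal.ofReal 4 by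
          rw [← ENNReal.ofReal_ofNat]; norm_num, ← ENNReal.ofReal_mul (by norm_num)]
        norm_num

/-- The common law of the weights. -/
theorem IsSubexpIID.exists_law [Fintype V] [IsProbabilityMeasure P] (h : IsSubexpIID P W ν K)
    (hK : 0 < K) (hν : 0 < ν) :
    ∃ μ : Measure ℂ, IsProbabilityMeasure μ ∧ IsCenteredSubexp μ (4 * K * √ν) ∧
      AEMeasurable (fun ω x => W x ω) P ∧
      P.map (fun ω x => W x ω) = Measure.pi fun _ : V => μ := by
  have hm := h.aemeasurable
  have hpi := h.indep.map_fun_eq_pi_map hm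
  have hL : 0 < 4 * K * √ν := by positivity
  rcases isEmpty_or_nonempty V with hV | ⟨⟨x⟩⟩
  · refine ⟨Measure.dirac 0, inferInstance, ⟨hL, ?_, ?_, ?_⟩, aemeasurable_pi_lambda _ hm, ?_⟩
    · exact integrable_dirac (by simp)
    · simp
    · simp
    · rw [hpi]
      congr 1
      exact funext fun x => (hV.false x).elim
  · have hexp : ∫⁻ w, ENNReal.ofReal (Real.exp (‖w‖ / (4 * K * √ν))) ∂(P.map (W x)) ≤ 2 := by
      rw [lintegral_map' (by fun_prop) (hm x)]
      exact h.lintegral_exp_le hK hν x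
    have hcont : AEStronglyMeasurable (fun w : ℂ => Real.exp (‖w‖ / (4 * K * √ν)))
        (P.map (W x)) := by fun_prop
    refine ⟨P.map (W x), Measure.isProbabilityMeasure_map (hm x), ⟨hL, ⟨hcont, ?_⟩, ?_, ?_⟩,
      aemeasurable_pi_lambda _ hm, ?_⟩
    · rw [hasFiniteIntegral_iff_ofReal (Eventually.of_forall fun w => (Real.exp_pos _).le)]
      exact hexp.trans_lt (by simp)
    · rw [integral_eq_lintegral_of_nonneg_ae (Eventually.of_forall fun w => (Real.exp_pos _).le)
        hcont]
      exact ENNReal.toReal_le_of_le_ofReal (by norm_num) (by simpa using hexp)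
    · rw [integral_map (f := fun w : ℂ => w) (hm x) aestronglyMeasurable_id]
      exact h.mean_zero x
    · rw [hpi]
      congr 1
      exact funext fun y => (h.identDistrib y x).map_eq

end Law

/-! ### Passage between the given probability space and the product law. -/

section Transfer

variable {V : Type u} [Fintype V] (G : SimpleGraph V) {Ω : Type v} [MeasurableSpace Ω]
  {P : Measure Ω} {W : V → Ω → ℂ} {ν K : ℝ}

theorem continuous_sq_norm_reweighted (z : ℂ) :
    Continuous (fun w : V → ℂ => ‖reweighted G w z‖ ^ 2) :=
  ((continuous_reweighted G).comp (Continuous.prodMk_right z)).norm.pow 2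

theorem secondMoment_map (hW : AEMeasurable (fun ω x => W x ω) P) :
    secondMoment G (P.map fun ω x => W x ω) (fun x w => w x) = secondMoment G P W := by
  ext z
  rw [secondMoment, secondMoment, integral_map hW
    (continuous_sq_norm_reweighted G z).aestronglyMeasurable]

theorem logSecondMomentWellDefined_map (hW : AEMeasurable (fun ω x => W x ω) P) {R : ℝ} :
    LogSecondMomentWellDefined G (P.map fun ω x => W x ω) (fun x w => w x) R ↔
      LogSecondMomentWellDefined G P W R := by
  rw [LogSecondMomentWellDefined, LogSecondMomentWellDefined, secondMoment_map G hW]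
  have : ∀ z : ℂ, Integrable (fun w : V → ℂ => ‖reweighted G w z‖ ^ 2)
      (P.map fun ω x => W x ω) ↔ Integrable (fun ω => ‖reweighted G (fun x => W x ω) z‖ ^ 2) P :=
    fun z => integrable_map_measure (continuous_sq_norm_reweighted G z).aestronglyMeasurable hW
  simp only [this]

theorem avgLogSecondMoment_map (hW : AEMeasurable (fun ω x => W x ω) P) {R : ℝ} :
    avgLogSecondMoment G (P.map fun ω x => W x ω) (fun x w => w x) R =
      avgLogSecondMoment G P W R := by
  rw [avgLogSecondMoment, avgLogSecondMoment, secondMoment_map G hW]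

theorem partitionFn_zero : partitionFn G (fun _ => 0) = 1 := by
  classical
  rw [partitionFn_eq_sum_indepSubsets, Finset.sum_eq_single ∅]
  · simp
  · intro I _ hI
    obtain ⟨x, hx⟩ := Finset.nonempty_iff_ne_empty.2 hI
    exact Finset.prod_eq_zero hx rfl
  · intro h
    exact (h (by simp [indepSubsets])).elim

theorem reweighted_apply_zero (w : V → ℂ) : reweighted G w 0 = 1 := by
  simp [reweighted, partitionPoly, partitionFn_zero]

theorem reweighted_zero (z : ℂ) : reweighted G (fun _ => 0) z = 1 := by
  simp [reweighted, partitionPoly, partitionFn_zero]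

theorem differentiable_partitionPoly (w : V → ℂ) : Differentiable ℂ (partitionPoly G w) := by
  have : partitionPoly G w = fun z => ∑ I ∈ indepSubsets G Finset.univ, ∏ x ∈ I, (z * w x) := by
    ext z
    rw [partitionPoly, partitionFn_eq_sum_indepSubsets]
  rw [this]
  fun_prop

theorem zeroCount_reweighted (w : V → ℂ) (r : ℝ) :
    zeroCount (reweighted G w) r = zeroCount (partitionPoly G w) r := by
  have h : ∀ z, analyticOrderAt (reweighted G w) z = analyticOrderAt (partitionPoly G w) z := by
    intro z
    have h1 : AnalyticAt ℂ (partitionPoly G w) z :=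
      ((differentiable_partitionPoly G w).differentiableOn (s := Set.univ)).analyticAt univ_mem
    have h2 : AnalyticAt ℂ (fun z : ℂ => Complex.exp (-(z * ∑ x, w x))) z := by fun_prop
    have h3 : reweighted G w =
        partitionPoly G w * fun z : ℂ => Complex.exp (-(z * ∑ x, w x)) := rfl
    rw [h3, analyticOrderAt_mul h1 h2, h2.analyticOrderAt_eq_zero.2 (Complex.exp_ne_zero _),
      add_zero]
  simp only [zeroCount, h]

/-- If the weights vanish almost surely, the second moment is identically `1`. -/
theorem logSecondMoment_of_ae_zero [IsProbabilityMeasure P] (h : ∀ x, W x =ᵐ[P] 0) (R : ℝ) :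
    LogSecondMomentWellDefined G P W R ∧ avgLogSecondMoment G P W R = 0 := by
  have h1 : ∀ z, (fun ω => ‖reweighted G (fun x => W x ω) z‖ ^ 2) =ᵐ[P] fun _ => 1 := by
    intro z
    filter_upwards [ae_all_iff.2 h] with ω hω
    have : (fun x => W x ω) = fun _ => 0 := funext hω
    rw [this, reweighted_zero, norm_one, one_pow]
  have h2 : secondMoment G P W = fun _ => 1 := by
    ext z
    rw [secondMoment, integral_congr_ae (h1 z)]
    simp
  rw [LogSecondMomentWellDefined, avgLogSecondMoment, h2]
  refine ⟨⟨fun z _ => ⟨(integrable_const _).congr (h1 z).symm, one_pos⟩,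
    circleIntegrable_const _ _ _⟩, ?_⟩
  rw [Real.circleAverage_const, Real.log_one]

theorem card_filter_adj_le_maxDegree [DecidableRel G.Adj] (x : V) [DecidablePred (G.Adj x)] :
    (Finset.univ.filter (G.Adj x)).card ≤ G.maxDegree := by
  refine le_trans (le_of_eq ?_) (G.degree_le_maxDegree x)
  rw [← SimpleGraph.card_neighborFinset_eq_degree, SimpleGraph.neighborFinset_eq_filter]
  congr!

end Transfer

/-! ### Bounds for one graph in terms of `ν`, `R` and `K`. -/

section Quantitative

variable {V : Type u} [Fintype V] (G : SimpleGraph V) [DecidableRel G.Adj] {Ω : Type v}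
  [MeasurableSpace Ω] {P : Measure Ω} [IsProbabilityMeasure P] {W : V → Ω → ℂ} {ν K R : ℝ}

theorem avgLogSecondMoment_bounds (hK : 0 < K) (h : IsSubexpIID P W ν K) (hR : 0 < R)
    (hs : (2 * G.maxDegree + 1) * (16 * K ^ 2 * (ν * R ^ 2)) ≤ 1 / 384) :
    LogSecondMomentWellDefined G P W R ∧
      |avgLogSecondMoment G P W R| ≤
        300000 * 256 * K ^ 4 * Fintype.card V * (1 + G.maxDegree) * ν ^ 2 * R ^ 4 := by
  rcases le_or_gt ν 0 with hν | hν
  · obtain ⟨h1, h2⟩ := logSecondMoment_of_ae_zero G (P := P) (W := W) (h.ae_eq_zero hν) R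
    refine ⟨h1, ?_⟩
    rw [h2, abs_zero]
    positivity
  · obtain ⟨μ, hμ, hsub, hW, hmap⟩ := h.exists_law hK hν
    have hsq : √ν ^ 2 = ν := Real.sq_sqrt hν.le
    have e2 : (R * (4 * K * √ν)) ^ 2 = 16 * K ^ 2 * (ν * R ^ 2) := by
      rw [mul_pow, mul_pow, mul_pow, hsq]; ring
    have e4 : (R * (4 * K * √ν)) ^ 4 = 256 * K ^ 4 * ν ^ 2 * R ^ 4 := by
      rw [show (R * (4 * K * √ν)) ^ 4 = ((R * (4 * K * √ν)) ^ 2) ^ 2 by ring, e2]; ring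
    obtain ⟨h1, -, h3⟩ := log_secondMoment_bounds G
      (fun x => by convert card_filter_adj_le_maxDegree G x) hsub hR.le
      (by rw [e2]; exact hs)
    rw [← hmap] at h1 h3
    refine ⟨(logSecondMomentWellDefined_map G hW).1 h1, ?_⟩
    rw [avgLogSecondMoment_map G hW, e4] at h3
    refine h3.trans (le_of_eq ?_)
    ring

theorem zeroCount_bounds (hK : 0 < K) (hν : 0 < ν) (h : IsSubexpIID P W ν K) (hR : 0 < R)
    (hs : (2 * G.maxDegree + 1) * (16 * K ^ 2 * (ν * R ^ 2)) ≤ 1 / 384) {r : ℝ} (hr : 0 < r)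
    (hrR : r < R) :
    ∫⁻ ω, zeroCount (partitionPoly G (fun x => W x ω)) r ∂P ≤
        ENNReal.ofReal (avgLogSecondMoment G P W R / (2 * Real.log (R / r))) ∧
      P (hasZeroEvent G W r) ≤
        ENNReal.ofReal (avgLogSecondMoment G P W R / (2 * Real.log (R / r))) := by
  obtain ⟨μ, hμ, hsub, hW, hmap⟩ := h.exists_law hK hν
  have hsq : √ν ^ 2 = ν := Real.sq_sqrt hν.le
  have e2 : (R * (4 * K * √ν)) ^ 2 = 16 * K ^ 2 * (ν * R ^ 2) := by
    rw [mul_pow, mul_pow, mul_pow, hsq]; ring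
  have hρ : R * (4 * K * √ν) ≤ 1 / 8 := by
    have h0 : (0 : ℝ) ≤ R * (4 * K * √ν) := by positivity
    have h1 : (0 : ℝ) ≤ 2 * G.maxDegree * (R * (4 * K * √ν)) ^ 2 := by positivity
    have h2 : (R * (4 * K * √ν)) ^ 2 ≤ 1 / 384 := by
      rw [← e2] at hs
      linarith
    nlinarith
  obtain ⟨h1, ⟨B, hB⟩, -⟩ := log_secondMoment_bounds G
    (fun x => by convert card_filter_adj_le_maxDegree G x) hsub hR.le
    (by rw [e2]; exact hs)
  obtain ⟨Y, hYm, hYi, hY, hYmean⟩ := exists_dominating_circleAverage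
    (P := Measure.pi fun _ : V => μ) (f := fun w => reweighted G w)
    (differentiable_reweighted G) (reweighted_apply_zero G)
    ((continuous_reweighted G).norm.pow 2).measurable hR (integrable_prod_exp hsub)
    (fun z hz w => sq_norm_reweighted_le G hsub.pos (by rw [hz]; exact hρ) w)
    (F := secondMoment G (Measure.pi fun _ : V => μ) (fun x w => w x)) (fun z => rfl)
    (measurable_secondMoment G) (fun z hz => (h1.1 z hz).2) hB
  have hlog : 0 < Real.log (R / r) := Real.log_pos ((one_lt_div hr).2 hrR)
  have hcount : ∀ w : V → ℂ, zeroCount (partitionPoly G w) r ≤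
      ENNReal.ofReal (Y w / (2 * Real.log (R / r))) := by
    intro w
    rw [← zeroCount_reweighted]
    refine (zeroCount_le_of_differentiable (differentiable_reweighted G w)
      (reweighted_apply_zero G w) hr hrR).trans (ENNReal.ofReal_le_ofReal ?_)
    rw [← div_div]
    gcongr
    linarith [hY w]
  -- Nonnegativity, a consequence of Jensen's formula, identifies the Lebesgue integral of the
  -- majorant with its mean.
  have hY0 : ∀ w, 0 ≤ Y w := by
    intro w
    have := circleAverage_log_norm_nonneg (differentiable_reweighted G w)
      (reweighted_apply_zero G w) hR
    linarith [hY w]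
  have hmean : ∫⁻ ω, ENNReal.ofReal (Y (fun x => W x ω) / (2 * Real.log (R / r))) ∂P =
      ENNReal.ofReal (avgLogSecondMoment G P W R / (2 * Real.log (R / r))) := by
    have e1 : ∫⁻ w, ENNReal.ofReal (Y w / (2 * Real.log (R / r))) ∂(P.map fun ω x => W x ω) =
        ∫⁻ ω, ENNReal.ofReal (Y (fun x => W x ω) / (2 * Real.log (R / r))) ∂P :=
      lintegral_map' (hYm.div_const _).ennreal_ofReal.aemeasurable hW
    rw [← e1, ← avgLogSecondMoment_map G hW, hmap, avgLogSecondMoment, ← hYmean,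
      ← integral_div, ofReal_integral_eq_lintegral_ofReal (hYi.div_const _)
        (Eventually.of_forall fun w => div_nonneg (hY0 w) (by positivity))]
  refine ⟨(lintegral_mono fun ω => hcount _).trans_eq hmean, ?_⟩
  rw [← hmean]
  have hm : AEMeasurable
      (fun ω => ENNReal.ofReal (Y (fun x => W x ω) / (2 * Real.log (R / r)))) P :=
    (hYm.div_const _).ennreal_ofReal.comp_aemeasurable hW
  -- Markov is applied to the measurable majorant, so measurability of the zero count or of the
  -- event plays no role.
  have hMarkov := mul_meas_ge_le_lintegral₀ hm 1
  rw [one_mul] at hMarkov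
  refine (measure_mono fun ω hω => ?_).trans hMarkov
  obtain ⟨z, hz, h0⟩ := hω
  exact (one_le_zeroCount hz (differentiable_partitionPoly G _) h0).trans (hcount _)

end Quantitative

/-! ### Choice of constants and the three statements. -/

section Main

/-- The three bounds for one graph, under a smallness condition. -/
theorem exists_quantitative_bounds {K : ℝ} (hK : 0 < K) :
    ∃ c > (0 : ℝ), ∃ C > (0 : ℝ),
      ∀ (V : Type u) [Fintype V] (G : SimpleGraph V) [DecidableRel G.Adj]
        (Ω : Type v) [MeasurableSpace Ω] (P : Measure Ω) [IsProbabilityMeasure P]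
        (W : V → Ω → ℂ) (ν : ℝ), 0 < ν → IsSubexpIID P W ν K →
        ∀ R : ℝ, 0 < R → R ≤ c / Real.sqrt ν → ν * R ^ 2 * (G.maxDegree : ℝ) ≤ c →
          LogSecondMomentWellDefined G P W R ∧
          |avgLogSecondMoment G P W R| ≤
            C * (Fintype.card V : ℝ) * (1 + (G.maxDegree : ℝ)) * ν ^ 2 * R ^ 4 ∧
          ∀ r : ℝ, 0 < r → r < R →
            ∫⁻ ω, zeroCount (partitionPoly G (fun x => W x ω)) r ∂P ≤
              ENNReal.ofReal (C * (Fintype.card V : ℝ) * (1 + (G.maxDegree : ℝ)) * ν ^ 2 * R ^ 4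
                / (2 * Real.log (R / r))) ∧
            P (hasZeroEvent G W r) ≤
              ENNReal.ofReal (C * (Fintype.card V : ℝ) * (1 + (G.maxDegree : ℝ)) * ν ^ 2 * R ^ 4
                / (2 * Real.log (R / r))) := by
  have hd : 0 < 1 / (18432 * K ^ 2) := by positivity
  -- `18432 = 16 · 3 · 384`, the `3` coming from `2νR²Δ + νR² ≤ 3c`; `c ≤ 1` is used for `νR² ≤ c² ≤
  -- c`.
  refine ⟨min 1 (1 / (18432 * K ^ 2)), lt_min one_pos hd, 300000 * 256 * K ^ 4, by positivity, ?_⟩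
  intro V _ G _ Ω _ P _ W ν hν h R hR hR1 hR2
  set c := min 1 (1 / (18432 * K ^ 2)) with hc
  have hc0 : 0 < c := lt_min one_pos hd
  have hc1 : c ≤ 1 := min_le_left _ _
  have hcK : 16 * K ^ 2 * (3 * c) ≤ 1 / 384 := by
    have : c ≤ 1 / (18432 * K ^ 2) := min_le_right _ _
    rw [le_div_iff₀ (by positivity)] at this
    linarith
  have hs0 : 0 < √ν := Real.sqrt_pos.2 hν
  have hνR : ν * R ^ 2 ≤ c := by
    rw [le_div_iff₀ hs0] at hR1
    have h1 : (R * √ν) ^ 2 ≤ c ^ 2 := pow_le_pow_left₀ (by positivity) hR1 2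
    rw [mul_pow, Real.sq_sqrt hν.le] at h1
    nlinarith
  have hs : (2 * G.maxDegree + 1) * (16 * K ^ 2 * (ν * R ^ 2)) ≤ 1 / 384 := by
    refine le_trans ?_ hcK
    have : (2 * G.maxDegree + 1) * (16 * K ^ 2 * (ν * R ^ 2)) =
        16 * K ^ 2 * (2 * (ν * R ^ 2 * G.maxDegree) + ν * R ^ 2) := by ring
    rw [this]
    gcongr
    linarith
  obtain ⟨h1, h2⟩ := avgLogSecondMoment_bounds G hK h hR hs
  refine ⟨h1, h2, fun r hr hrR => ?_⟩
  obtain ⟨h3, h4⟩ := zeroCount_bounds G hK hν h hR hs hr hrR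
  have hlog : 0 < Real.log (R / r) := Real.log_pos ((one_lt_div hr).2 hrR)
  have h5 : ENNReal.ofReal (avgLogSecondMoment G P W R / (2 * Real.log (R / r))) ≤
      ENNReal.ofReal (300000 * 256 * K ^ 4 * (Fintype.card V : ℝ) * (1 + (G.maxDegree : ℝ)) *
        ν ^ 2 * R ^ 4 / (2 * Real.log (R / r))) := by
    refine ENNReal.ofReal_le_ofReal ?_
    gcongr
    exact (le_abs_self _).trans h2
  exact ⟨h3.trans h5, h4.trans h5⟩

theorem one_add_maxDegree_le_card {V : Type u} [Fintype V] [Nonempty V] (G : SimpleGraph V)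
    [DecidableRel G.Adj] : (1 + (G.maxDegree : ℝ)) ≤ Fintype.card V := by
  have := G.maxDegree_lt_card_verts
  have h : 1 + G.maxDegree ≤ Fintype.card V := by omega
  exact_mod_cast h

/-- Since `1 + Δ ≤ |V|`, the square of `νR²(1 + Δ)` is at most `ν²R⁴(1 + Δ)|V|`; the limit
hypothesis therefore forces the smallness condition eventually. -/
theorem tendsto_avgLogSecondMoment {K : ℝ} (hK : 0 < K)
    (V : ℕ → Type u) [∀ n, Fintype (V n)] (G : ∀ n, SimpleGraph (V n))
    [∀ n, DecidableRel (G n).Adj]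
    (Ω : ℕ → Type v) [∀ n, MeasurableSpace (Ω n)] (P : ∀ n, Measure (Ω n))
    [∀ n, IsProbabilityMeasure (P n)]
    (W : ∀ n, V n → Ω n → ℂ) (ν R : ℕ → ℝ)
    (h : ∀ n, IsSubexpIID (P n) (W n) (ν n) K) (hR : ∀ n, 0 < R n)
    (hlim : Tendsto (fun n => ν n ^ 2 * R n ^ 4 * (1 + ((G n).maxDegree : ℝ)) *
      (Fintype.card (V n) : ℝ)) atTop (𝓝 0)) :
    (∀ᶠ n in atTop, LogSecondMomentWellDefined (G n) (P n) (W n) (R n)) ∧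
      Tendsto (fun n => avgLogSecondMoment (G n) (P n) (W n) (R n)) atTop (𝓝 0) := by
  set s := fun n => ν n ^ 2 * R n ^ 4 * (1 + ((G n).maxDegree : ℝ)) * (Fintype.card (V n) : ℝ)
    with hs
  set δ : ℝ := 1 / (384 * (32 * K ^ 2)) with hδ
  have hδ0 : 0 < δ := by positivity
  have key : ∀ᶠ n in atTop, LogSecondMomentWellDefined (G n) (P n) (W n) (R n) ∧
      |avgLogSecondMoment (G n) (P n) (W n) (R n)| ≤ 300000 * 256 * K ^ 4 * s n := by
    filter_upwards [hlim.eventually (gt_mem_nhds (pow_pos hδ0 2))] with n hn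
    rcases isEmpty_or_nonempty (V n) with hV | hV
    · obtain ⟨h1, h2⟩ := logSecondMoment_of_ae_zero (G n) (P := P n) (W := W n)
        (fun x => (hV.false x).elim) (R n)
      refine ⟨h1, ?_⟩
      rw [h2, abs_zero]
      simp only [hs]
      positivity
    · have hcard := one_add_maxDegree_le_card (G n)
      have hD0 : (0 : ℝ) ≤ (G n).maxDegree := by positivity
      have h1 : (ν n * R n ^ 2 * (1 + (G n).maxDegree)) ^ 2 ≤ δ ^ 2 := by
        refine le_trans ?_ hn.le
        calc _ = ν n ^ 2 * R n ^ 4 * (1 + ((G n).maxDegree : ℝ)) * (1 + (G n).maxDegree) := by ring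
          _ ≤ _ := mul_le_mul_of_nonneg_left hcard (by positivity)
      have h2 : ν n * R n ^ 2 * (1 + (G n).maxDegree) ≤ δ := (abs_le_of_sq_le_sq' h1 hδ0.le).2
      obtain ⟨h3, h4⟩ := avgLogSecondMoment_bounds (G n) hK (h n) (hR n) (by
        rcases le_or_gt (ν n) 0 with hν | hν
        · have h5 : 0 ≤ (2 * (G n).maxDegree + 1) * (16 * K ^ 2 * (-(ν n) * R n ^ 2)) :=
            mul_nonneg (by positivity) (mul_nonneg (by positivity)
              (mul_nonneg (by linarith) (by positivity)))
          linarith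
        · have h5 : (2 * (G n).maxDegree + 1) * (16 * K ^ 2 * (ν n * R n ^ 2)) ≤
              32 * K ^ 2 * (ν n * R n ^ 2 * (1 + (G n).maxDegree)) := by
            have : 0 ≤ K ^ 2 * (ν n * R n ^ 2) := by positivity
            linarith
          refine h5.trans ?_
          calc 32 * K ^ 2 * (ν n * R n ^ 2 * (1 + (G n).maxDegree)) ≤ 32 * K ^ 2 * δ := by gcongr
            _ = 1 / 384 := by rw [hδ]; field_simp)
      refine ⟨h3, h4.trans (le_of_eq ?_)⟩
      simp only [hs]
      ring
  refine ⟨key.mono fun n hn => hn.1, ?_⟩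
  refine squeeze_zero_norm' (key.mono fun n hn => hn.2) ?_
  simpa using hlim.const_mul (300000 * 256 * K ^ 4)

/-- The radius is chosen so that `M ν²R⁴ = M^{-4β}`. If `M^{-2β} ≤ c`, the smallness conditions hold
because `Δ ≤ √M`; otherwise `M^{-4β} > c²` and the bound is trivial. The constant is the sum of
those for the two cases. -/
theorem exists_hasZeroEvent_bound {K : ℝ} (hK : 0 < K) {ε : ℝ} (hε0 : 0 < ε) (hε1 : ε < 1) :
    ∃ C > (0 : ℝ),
      ∀ (V : Type u) [Fintype V] (G : SimpleGraph V) [DecidableRel G.Adj]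
        (Ω : Type v) [MeasurableSpace Ω] (P : Measure Ω) [IsProbabilityMeasure P]
        (W : V → Ω → ℂ) (ν : ℝ), 0 < ν → IsSubexpIID P W ν K → ∀ β : ℝ, 0 < β → β < 1 / 4 →
          P (hasZeroEvent G W ((1 - ε) * (1 / Real.sqrt ν * sizeParam G ^ (-(1 / 4) - β)))) ≤
            ENNReal.ofReal (C * sizeParam G ^ (-(4 * β))) := by
  obtain ⟨c, hc, C, hC, hmain⟩ := exists_quantitative_bounds.{u, v} hK
  have hl : 0 < Real.log (1 / (1 - ε)) :=
    Real.log_pos ((one_lt_div (by linarith)).2 (by linarith))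
  set l := Real.log (1 / (1 - ε)) with hldef
  refine ⟨C / (2 * l) + 1 / c ^ 2, by positivity, ?_⟩
  intro V _ G _ Ω _ P _ W ν hν h β hβ0 hβ1
  set M := sizeParam G with hM
  have hs0 : 0 < √ν := Real.sqrt_pos.2 hν
  rcases isEmpty_or_nonempty V with hV | hV
  -- A zero base with nonzero exponent gives `0`, so the disc is empty.
  · have hM0 : M = 0 := by simp [hM, sizeParam]
    rw [hM0, Real.zero_rpow (by linarith)]
    simp [hasZeroEvent]
  · have hcard := one_add_maxDegree_le_card G
    have hD0 : (0 : ℝ) ≤ G.maxDegree := by positivity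
    have hM2 : (1 + (G.maxDegree : ℝ)) ^ 2 ≤ M := by
      rw [hM, sizeParam, sq]
      gcongr
    have hM1 : 1 ≤ M := by nlinarith
    have hM0 : 0 < M := by linarith
    have hpow : M ^ (-(4 * β)) = (M ^ (-(2 * β))) ^ 2 := by
      rw [← Real.rpow_natCast, ← Real.rpow_mul hM0.le]
      congr 1
      push_cast
      ring
    have hp0 : 0 < M ^ (-(2 * β)) := Real.rpow_pos_of_pos hM0 _
    rcases le_or_gt (M ^ (-(2 * β))) c with hsmall | hlarge
    · set R := 1 / √ν * M ^ (-(1 / 4) - β) with hR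
      have hRp : 0 < M ^ (-(1 / 4) - β) := Real.rpow_pos_of_pos hM0 _
      have hR0 : 0 < R := by positivity
      have hR2 : ν * R ^ 2 = M ^ (-(1 / 2) - 2 * β) := by
        rw [hR, mul_pow, div_pow, Real.sq_sqrt hν.le, one_pow, ← Real.rpow_natCast (M ^ _),
          ← Real.rpow_mul hM0.le, ← mul_assoc, mul_one_div_cancel hν.ne', one_mul]
        congr 1
        push_cast
        ring
      have hR4 : ν ^ 2 * R ^ 4 = M⁻¹ * M ^ (-(4 * β)) := by
        rw [show ν ^ 2 * R ^ 4 = (ν * R ^ 2) ^ 2 by ring, hR2, ← Real.rpow_natCast (M ^ _),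
          ← Real.rpow_mul hM0.le, ← Real.rpow_neg_one, ← Real.rpow_add hM0]
        congr 1
        push_cast
        ring
      -- `-1/4 - β ≤ -2β` is exactly `β ≤ 1/4`.
      have hRc : R ≤ c / √ν := by
        rw [hR, one_div_mul_eq_div]
        gcongr
        exact (Real.rpow_le_rpow_of_exponent_le hM1 (by linarith)).trans hsmall
      have hRD : ν * R ^ 2 * G.maxDegree ≤ c := by
        have hD : (G.maxDegree : ℝ) ≤ M ^ (1 / 2 : ℝ) := by
          rw [← Real.sqrt_eq_rpow]
          exact Real.le_sqrt_of_sq_le (by nlinarith)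
        calc ν * R ^ 2 * G.maxDegree ≤ M ^ (-(1 / 2) - 2 * β) * M ^ (1 / 2 : ℝ) := by
              rw [hR2]
              gcongr
          _ = M ^ (-(2 * β)) := by
              rw [← Real.rpow_add hM0]
              congr 1
              ring
          _ ≤ c := hsmall
      have hr : 0 < (1 - ε) * R := mul_pos (by linarith) hR0
      have hrR : (1 - ε) * R < R := by nlinarith
      refine (((hmain V G Ω P W ν hν h R hR0 hRc hRD).2.2 _ hr hrR).2).trans
        (ENNReal.ofReal_le_ofReal ?_)
      have e1 : R / ((1 - ε) * R) = 1 / (1 - ε) := by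
        have : 1 - ε ≠ 0 := by linarith
        field_simp
      have e2 : C * (Fintype.card V : ℝ) * (1 + (G.maxDegree : ℝ)) * ν ^ 2 * R ^ 4 =
          C * M ^ (-(4 * β)) := by
        calc _ = C * (M * (ν ^ 2 * R ^ 4)) := by rw [hM, sizeParam]; ring
          _ = _ := by rw [hR4, mul_inv_cancel_left₀ hM0.ne']
      rw [e1, ← hldef, e2, add_mul, div_mul_eq_mul_div]
      have : 0 ≤ 1 / c ^ 2 * M ^ (-(4 * β)) := by
        rw [hpow]
        positivity
      linarith
    · refine prob_le_one.trans ?_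
      rw [← ENNReal.ofReal_one]
      refine ENNReal.ofReal_le_ofReal ?_
      rw [hpow, add_mul]
      have h1 : c ^ 2 ≤ (M ^ (-(2 * β))) ^ 2 := by gcongr
      have h2 : 1 ≤ 1 / c ^ 2 * (M ^ (-(2 * β))) ^ 2 := by
        rw [one_div_mul_eq_div, one_le_div (by positivity)]
        exact h1
      have h3 : 0 ≤ C / (2 * l) * (M ^ (-(2 * β))) ^ 2 := by positivity
      linarith

end Main

end Hardcore

theorem mainTheorem6 (K : ℝ) (hK : 0 < K) :
    -- quantitative bounds for one finite graph, with constants depending only on `K`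
    (∃ c > (0 : ℝ), ∃ C > (0 : ℝ),
      ∀ (V : Type u) [Fintype V] (G : SimpleGraph V) [DecidableRel G.Adj]
        (Ω : Type v) [MeasurableSpace Ω] (P : Measure Ω) [IsProbabilityMeasure P]
        (W : V → Ω → ℂ) (ν : ℝ), 0 < ν → Hardcore.IsSubexpIID P W ν K →
        ∀ R : ℝ, 0 < R → R ≤ c / Real.sqrt ν → ν * R ^ 2 * (G.maxDegree : ℝ) ≤ c →
          Hardcore.LogSecondMomentWellDefined G P W R ∧
          |Hardcore.avgLogSecondMoment G P W R| ≤
            C * (Fintype.card V : ℝ) * (1 + (G.maxDegree : ℝ)) * ν ^ 2 * R ^ 4 ∧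
          ∀ r : ℝ, 0 < r → r < R →
            ∫⁻ ω, Hardcore.zeroCount (Hardcore.partitionPoly G (fun x => W x ω)) r ∂P ≤
              ENNReal.ofReal (C * (Fintype.card V : ℝ) * (1 + (G.maxDegree : ℝ)) * ν ^ 2 * R ^ 4
                / (2 * Real.log (R / r))) ∧
            P (Hardcore.hasZeroEvent G W r) ≤
              ENNReal.ofReal (C * (Fintype.card V : ℝ) * (1 + (G.maxDegree : ℝ)) * ν ^ 2 * R ^ 4
                / (2 * Real.log (R / r)))) ∧
    -- asymptotic second-moment bound along a sequence of graphs
    (∀ (V : ℕ → Type u) [∀ n, Fintype (V n)] (G : ∀ n, SimpleGraph (V n))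
        [∀ n, DecidableRel (G n).Adj]
        (Ω : ℕ → Type v) [∀ n, MeasurableSpace (Ω n)] (P : ∀ n, Measure (Ω n))
        [∀ n, IsProbabilityMeasure (P n)]
        (W : ∀ n, V n → Ω n → ℂ) (ν R : ℕ → ℝ),
        (∀ n, Hardcore.IsSubexpIID (P n) (W n) (ν n) K) → (∀ n, 0 < R n) →
        Tendsto (fun n => ν n ^ 2 * R n ^ 4 * (1 + ((G n).maxDegree : ℝ)) *
          (Fintype.card (V n) : ℝ)) atTop (𝓝 0) →
        (∀ᶠ n in atTop, Hardcore.LogSecondMomentWellDefined (G n) (P n) (W n) (R n)) ∧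
        Tendsto (fun n => Hardcore.avgLogSecondMoment (G n) (P n) (W n) (R n)) atTop (𝓝 0)) ∧
    -- zero-freeness along a sequence of graphs, with a constant depending only on `ε` and `K`
    (∀ ε : ℝ, 0 < ε → ε < 1 → ∃ C > (0 : ℝ),
      ∀ (V : ℕ → Type u) [∀ n, Fintype (V n)] (G : ∀ n, SimpleGraph (V n))
        [∀ n, DecidableRel (G n).Adj]
        (Ω : ℕ → Type v) [∀ n, MeasurableSpace (Ω n)] (P : ∀ n, Measure (Ω n))
        [∀ n, IsProbabilityMeasure (P n)]
        (W : ∀ n, V n → Ω n → ℂ) (ν : ℕ → ℝ),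
        (∀ n, 0 < ν n) → (∀ n, Hardcore.IsSubexpIID (P n) (W n) (ν n) K) →
        ∀ β : ℝ, 0 < β → β < 1 / 4 →
          ∀ n, P n (Hardcore.hasZeroEvent (G n) (W n)
              ((1 - ε) * (1 / Real.sqrt (ν n) *
                Hardcore.sizeParam (G n) ^ (-(1 / 4) - β)))) ≤
            ENNReal.ofReal (C * Hardcore.sizeParam (G n) ^ (-(4 * β)))) := by
  refine ⟨Hardcore.exists_quantitative_bounds hK, ?_, ?_⟩
  · intro V _ G _ Ω _ P _ W ν R h hR hlim
    exact Hardcore.tendsto_avgLogSecondMoment hK V G Ω P W ν R h hR hlim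
  · intro ε hε0 hε1
    obtain ⟨C, hC, h⟩ := Hardcore.exists_hasZeroEvent_bound.{u, v} hK hε0 hε1
    refine ⟨C, hC, ?_⟩
    intro V _ G _ Ω _ P _ W ν hν hW β hβ0 hβ1 n
    exact h (V n) (G n) (Ω n) (P n) (W n) (ν n) (hν n) (hW n) β hβ0 hβ1
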